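/- For $R:\mathbb{R}\to\mathbb{C}$ integrable write $\widehat R(t)=\int_{-\infty}^\infty e^{-2\pi i x t}R(x)\,dx$. Call $R$ admissible if $R\in L^1(\mathbb{R})$ and $\widehat R$ is supported in $[-1,1]$; such an $R$ is identified with the entire function that represents it, so that $R(z)$ makes sense for all $z\in\mathbb{C}$. Put $$M(R)=\int_{-\infty}^{\infty}R(x)\left\{1-\left(\frac{\sin\pi x}{\pi x}\right)^2\right\}dx .$$ For $\beta>0$ let $\Omega_\beta$ be the set of admissible functions $R$ that are nonnegative on $\mathbb{R}$ and satisfy $R(\beta)\ge 1$ and $R(-\beta)\ge1$, and let $\Delta(\beta)=\inf_{R\in\Omega_\beta}M(R)$. For $w,z\in\mathbb{C}$ let $K(w,z)=f(\overline w,z)+c(\overline w)\,g(z)+d(\overline w)\,h(z)$, where $$c(w)=\frac{\cos(\pi w)-\pi w\sin(\pi w)}{(1-2\pi^2w^2)\big(\cos(2^{-1/2})-2^{-1/2}\sin(2^{-1/2})\big)},\qquad d(w)=\frac{2\pi w\cos(\pi w)}{(1-2\pi^2w^2)\,2^{1/2}\cos(2^{-1/2})},$$ $$f(w,z)=\frac{2\pi^2w^2}{2\pi^2w^2-1}\,\frac{\sin\pi(z-w)}{\pi(z-w)},\qquad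 g(z)=\frac{2^{1/2}\sin(2^{-1/2})\cos(\pi z)-2\pi z\cos(2^{-1/2})\sin(\pi z)}{1-2\pi^2z^2},$$ $$h(z)=\frac{2\pi z\sin(2^{-1/2})\cos(\pi z)-2^{1/2}\cos(2^{-1/2})\sin(\pi z)}{1-2\pi^2z^2},$$ all removable singularities (in $z$ at $\pm 1/(\pi\sqrt2)$, at $z=w$ in $f$, and in $w$ at $\pm1/(\pi\sqrt2)$ in $K$) being filled in by the appropriate limits. Theorem. For every $\beta>0$ the infimum $\Delta(\beta)$ is attained, and $$\Delta(\beta)=\frac{2}{K(\beta,\beta)+|K(\beta,-\beta)|}=2\left\{1-\left|\frac{\sin2\pi\beta}{2\pi\beta}\right|\right\}+O\!\left(\frac1{\beta^2}\right),$$ where the implied constant is absolute. The functions $R\in\Omega_\beta$ with $M(R)=\Delta(\beta)$ are exactly the following. (i) If $K(\beta,-\beta)=0$, the functions $$R(z)=\frac{1}{K(\beta,\beta)^2}\big(c_1K(\beta,z)+c_2K(-\beta,z)\big)\big(\overline{c_1}K(\beta,z)+\overline{c_2}K(-\beta,z)\big),$$ where $c_1,c_2\in\mathbb{C}$ with $|c_1|=|c_2|=1$.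 (ii) If $K(\beta,-\beta)\ne0$, the single function $$R(z)=\frac{\left(\frac{K(\beta,-\beta)}{|K(\beta,-\beta)|}K(\beta,z)+K(-\beta,z)\right)^2}{\big(K(\beta,\beta)+|K(\beta,-\beta)|\big)^2}.$$ -/

import Mathlib

open MeasureTheory Filter Topology
open scoped Real ComplexConjugate FourierTransform

namespace PairCorrelation

noncomputable section

/-- Density of the pair correlation measure, `1 - (sin π x / (π x)) ^ 2` (with its limit `0` at
`x = 0`). -/
def density (x : ℝ) : ℝ := 1 - (Real.sinc (π * x)) ^ 2

/-- Admissible functions: functions `R` in `L¹(ℝ)` whose Fourier transform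
`t ↦ ∫ exp (-2 π i x t) R x dx` is supported in `[-1, 1]`. Such a function agrees almost everywhere
with the restriction to `ℝ` of exactly one entire function, and this entire function represents
it here, so that point values `R z` make sense for every complex `z`. -/
structure IsAdmissible (R : ℂ → ℂ) : Prop where
  entire : Differentiable ℂ R
  integrable : Integrable (fun x : ℝ => R (x : ℂ))
  fourier_support : Function.support (𝓕 (fun x : ℝ => R (x : ℂ))) ⊆ Set.Icc (-1 : ℝ) 1

/-- The functional `M R = ∫ R(x) (1 - (sin π x / (π x)) ^ 2) dx`. -/
def M (R : ℂ → ℂ) : ℂ := ∫ x : ℝ, R (x : ℂ) * (density x : ℂ)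

/-- The class `Ω β` of admissible functions that are (real and) nonnegative on the real line and
at least `1` at `β` and at `-β`. -/
def Omega (β : ℝ) : Set (ℂ → ℂ) :=
  {R | IsAdmissible R ∧ (∀ x : ℝ, (R (x : ℂ)).im = 0 ∧ 0 ≤ (R (x : ℂ)).re) ∧
    1 ≤ (R (β : ℂ)).re ∧ 1 ≤ (R (-(β : ℂ))).re}

/-- The (real) values that `M` takes on `Ω β`. -/
def values (β : ℝ) : Set ℝ := {m | ∃ R ∈ Omega β, M R = (m : ℂ)}

/-- `Δ β`, the infimum of `M` over `Ω β`. -/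
def Delta (β : ℝ) : ℝ := sInf (values β)

/-- `R` realizes the infimum that defines `Δ β`. -/
def IsExtremal (β : ℝ) (R : ℂ → ℂ) : Prop := R ∈ Omega β ∧ M R = (Delta β : ℂ)

/-- The number `2 ^ (-1/2)`. -/
def a : ℂ := ((1 / √2 : ℝ) : ℂ)

/-- `1 - 2 π² z²`, which vanishes exactly at `z = ±1 / (π √2)`. -/
def q (z : ℂ) : ℂ := 1 - 2 * (π : ℂ) ^ 2 * z ^ 2

/-- `sin (π z) / (π z)`, with the value `1` at `z = 0`. -/
def sincPi (z : ℂ) : ℂ := if z = 0 then 1 else Complex.sin (π * z) / (π * z)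

def c (w : ℂ) : ℂ :=
  (Complex.cos (π * w) - π * w * Complex.sin (π * w)) /
    (q w * (Complex.cos a - a * Complex.sin a))

def d (w : ℂ) : ℂ :=
  2 * π * w * Complex.cos (π * w) / (q w * ((√2 : ℝ) : ℂ) * Complex.cos a)

def f (w z : ℂ) : ℂ :=
  2 * (π : ℂ) ^ 2 * w ^ 2 / (2 * (π : ℂ) ^ 2 * w ^ 2 - 1) * sincPi (z - w)

def gFormula (z : ℂ) : ℂ :=
  (((√2 : ℝ) : ℂ) * Complex.sin a * Complex.cos (π * z) -
    2 * π * z * Complex.cos a * Complex.sin (π * z)) / q z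

def hFormula (z : ℂ) : ℂ :=
  (2 * π * z * Complex.sin a * Complex.cos (π * z) -
    ((√2 : ℝ) : ℂ) * Complex.cos a * Complex.sin (π * z)) / q z

/-- The entire function `g`: its formula, and the limit of the formula at the two removable
singularities. -/
def g (z : ℂ) : ℂ := if q z = 0 then limUnder (𝓝[≠] z) gFormula else gFormula z

/-- The entire function `h`: its formula, and the limit of the formula at the two removable
singularities. -/
def h (z : ℂ) : ℂ := if q z = 0 then limUnder (𝓝[≠] z) hFormula else hFormula z

def kernelFormula (w z : ℂ) : ℂ := f (conj w) z + c (conj w) * g z + d (conj w) * h z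

/-- The kernel `K(w, z)`, interpreted as a limit in `w` at the points `w = ±1 / (π √2)`. -/
def K (w z : ℂ) : ℂ :=
  if q (conj w) = 0 then limUnder (𝓝[≠] w) (fun v => kernelFormula v z) else kernelFormula w z

end

end PairCorrelation

namespace PairCorrelation

open scoped SchwartzMap ContDiff in
/-- On `L¹ ∩ L²` the Fourier transform of `L²` agrees with the Fourier integral. -/
theorem coeFn_fourier_toLp {u : ℝ → ℂ} (h1 : Integrable u) (h2 : MemLp u 2) :
    ((𝓕 (h2.toLp u) : Lp ℂ 2 (volume : Measure ℝ)) : ℝ → ℂ) =ᵐ[volume] 𝓕 u := by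
  have hcont : Continuous (𝓕 u) :=
    VectorFourier.fourierIntegral_continuous Real.continuous_fourierChar
      (by exact continuous_inner) h1
  refine ae_eq_of_integral_contDiff_smul_eq ?_ hcont.locallyIntegrable ?_
  · exact (Lp.memLp _).locallyIntegrable (by norm_num)
  · intro s hs hsupp
    have hs' : ContDiff ℝ ∞ (fun x => (s x : ℂ)) := Complex.ofRealCLM.contDiff.comp hs
    have hsupp' : HasCompactSupport (fun x => (s x : ℂ)) :=
      hsupp.comp_left (g := ((↑) : ℝ → ℂ)) Complex.ofReal_zero
    let S : 𝓢(ℝ, ℂ) := hsupp'.toSchwartzMap hs'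
    have hS : ∀ x, S x = s x := fun x => rfl
    have key := congrArg (fun T : 𝓢'(ℝ, ℂ) => T S)
      (Lp.fourier_toTemperedDistribution_eq (h2.toLp u))
    simp only [TemperedDistribution.fourier_apply, Lp.toTemperedDistribution_apply] at key
    have l1 : ∫ x, (𝓕 S) x • (h2.toLp u : ℝ → ℂ) x = ∫ x, (𝓕 S) x • u x :=
      integral_congr_ae (by filter_upwards [h2.coeFn_toLp] with x hx; rw [hx])
    have l2 : ∫ x, (𝓕 S) x • u x = ∫ x, S x • (𝓕 u) x := by
      have := VectorFourier.integral_fourierIntegral_smul_eq_flip (L := innerₗ ℝ)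
        (μ := (volume : Measure ℝ)) (ν := (volume : Measure ℝ)) Real.continuous_fourierChar
        (by exact continuous_inner) S.integrable h1
      rw [flip_innerₗ] at this
      exact this
    rw [l1, l2] at key
    simpa [hS] using key.symm

theorem memLp_fourier {u : ℝ → ℂ} (h1 : Integrable u) (h2 : MemLp u 2) : MemLp (𝓕 u) 2 :=
  (memLp_congr_ae (coeFn_fourier_toLp h1 h2)).1 (Lp.memLp _)

/-- Plancherel's formula on `L¹ ∩ L²`. -/
theorem integral_conj_fourier_mul_fourier {u v : ℝ → ℂ} (hu : Integrable u) (hu2 : MemLp u 2)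
    (hv : Integrable v) (hv2 : MemLp v 2) :
    ∫ x, 𝓕 u x * conj (𝓕 v x) = ∫ x, u x * conj (v x) := by
  have key := Lp.inner_fourier_eq (hv2.toLp v) (hu2.toLp u)
  rw [L2.inner_def, L2.inner_def] at key
  have l1 := integral_congr_ae (μ := volume) (f := fun x => inner ℂ
      ((𝓕 (hv2.toLp v) : Lp ℂ 2 (volume : Measure ℝ)) x)
      ((𝓕 (hu2.toLp u) : Lp ℂ 2 (volume : Measure ℝ)) x))
      (g := fun x => 𝓕 u x * conj (𝓕 v x)) (by
    filter_upwards [coeFn_fourier_toLp hu hu2, coeFn_fourier_toLp hv hv2] with x h1 h2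
    simp [h1, h2])
  have l2 := integral_congr_ae (μ := volume) (f := fun x => inner ℂ
      ((hv2.toLp v : Lp ℂ 2 (volume : Measure ℝ)) x)
      ((hu2.toLp u : Lp ℂ 2 (volume : Measure ℝ)) x))
      (g := fun x => u x * conj (v x)) (by
    filter_upwards [hu2.coeFn_toLp, hv2.coeFn_toLp] with x h1 h2
    simp [h1, h2])
  rw [← l1, ← l2]
  exact key

/-- Square integrable functions supported in `[-1/2, 1/2]`. -/
structure IsProfile (φ : ℝ → ℂ) : Prop where
  memLp : MemLp φ 2
  eq_zero : ∀ t, t ∉ Set.Icc (-(1 / 2) : ℝ) (1 / 2) → φ t = 0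

/-- The Fourier transform `z ↦ ∫ φ t exp (-2 π i z t) dt` at complex arguments. -/
noncomputable def transform (φ : ℝ → ℂ) (z : ℂ) : ℂ :=
  ∫ t : ℝ, φ t * Complex.exp (-(2 * π * Complex.I * z * t))

theorem IsProfile.integrable {φ : ℝ → ℂ} (hφ : IsProfile φ) : Integrable φ := by
  have h1 : IntegrableOn φ (Set.Icc (-(1 / 2) : ℝ) (1 / 2)) :=
    (hφ.memLp.restrict _).integrable (by norm_num)
  refine (integrableOn_iff_integrable_of_support_subset ?_).1 h1
  intro t ht
  by_contra h
  exact ht (hφ.eq_zero t h)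

theorem transform_ofReal (φ : ℝ → ℂ) (x : ℝ) : transform φ x = 𝓕 φ x := by
  rw [Real.fourier_real_eq_integral_exp_smul]
  unfold transform
  congr 1
  ext t
  rw [smul_eq_mul, mul_comm]
  congr 2
  push_cast
  ring

theorem norm_exp_le {t : ℝ} (ht : t ∈ Set.Icc (-(1 / 2) : ℝ) (1 / 2)) (z : ℂ) :
    ‖Complex.exp (-(2 * π * Complex.I * z * t))‖ ≤ Real.exp (π * ‖z‖) := by
  refine (Complex.norm_exp_le_exp_norm _).trans (Real.exp_le_exp.2 ?_)
  have h : |t| ≤ 1 / 2 := abs_le.2 ⟨by linarith [ht.1], ht.2⟩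
  simp only [norm_neg, norm_mul, Complex.norm_ofNat, Complex.norm_real, Complex.norm_I, mul_one,
    Real.norm_eq_abs, abs_of_pos Real.pi_pos]
  nlinarith [mul_nonneg Real.pi_pos.le (norm_nonneg z)]

theorem IsProfile.differentiable_transform {φ : ℝ → ℂ} (hφ : IsProfile φ) :
    Differentiable ℂ (transform φ) := by
  intro z₀
  have hmeas : ∀ z : ℂ, AEStronglyMeasurable
      (fun t : ℝ => φ t * Complex.exp (-(2 * π * Complex.I * z * t))) volume := fun z =>
    hφ.integrable.aestronglyMeasurable.mul (by fun_prop)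
  have hbound : ∀ t : ℝ, ∀ z : ℂ,
      ‖φ t * Complex.exp (-(2 * π * Complex.I * z * t))‖ ≤ ‖φ t‖ * Real.exp (π * ‖z‖) := by
    intro t z
    rw [norm_mul]
    by_cases ht : t ∈ Set.Icc (-(1 / 2) : ℝ) (1 / 2)
    · gcongr
      exact norm_exp_le ht z
    · simp [hφ.eq_zero t ht]
  refine (hasDerivAt_integral_of_dominated_loc_of_deriv_le (μ := volume)
    (F := fun z (t : ℝ) => φ t * Complex.exp (-(2 * π * Complex.I * z * t)))
    (F' := fun z (t : ℝ) => φ t * (Complex.exp (-(2 * π * Complex.I * z * t)) *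
      (-(2 * π * Complex.I * 1 * t))))
    (bound := fun t => ‖φ t‖ * (Real.exp (π * (‖z₀‖ + 1)) * π))
    (Metric.ball_mem_nhds z₀ one_pos) (Eventually.of_forall hmeas) ?_ ?_ ?_ ?_ ?_).2.differentiableAt
  · exact Integrable.mono' (hφ.integrable.norm.mul_const _) (hmeas z₀)
      (Eventually.of_forall fun t => hbound t z₀)
  · exact hφ.integrable.aestronglyMeasurable.mul (by fun_prop)
  · refine Eventually.of_forall fun t z hz => ?_
    rw [norm_mul]
    by_cases ht : t ∈ Set.Icc (-(1 / 2) : ℝ) (1 / 2)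
    · have hz' : ‖z‖ ≤ ‖z₀‖ + 1 := by
        have := norm_le_norm_add_norm_sub' z z₀
        rw [Metric.mem_ball, dist_eq_norm] at hz
        linarith
      rw [norm_mul]
      gcongr
      · exact (norm_exp_le ht z).trans (Real.exp_le_exp.2 (by gcongr))
      · have h : |t| ≤ 1 / 2 := abs_le.2 ⟨by linarith [ht.1], ht.2⟩
        simp only [norm_neg, norm_mul, Complex.norm_ofNat, Complex.norm_real, Complex.norm_I,
          mul_one, Real.norm_eq_abs, abs_of_pos Real.pi_pos]
        nlinarith [Real.pi_pos]
    · simp [hφ.eq_zero t ht]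
  · exact hφ.integrable.norm.mul_const _
  · refine Eventually.of_forall fun t z _ => ?_
    refine HasDerivAt.const_mul _ (HasDerivAt.cexp ?_)
    exact (((hasDerivAt_id z).const_mul (2 * π * Complex.I)).mul_const (t : ℂ)).neg

theorem IsProfile.reflect {φ : ℝ → ℂ} (hφ : IsProfile φ) : IsProfile (fun t => φ (-t)) :=
  ⟨hφ.memLp.comp_measurePreserving (Measure.measurePreserving_neg volume), fun t ht =>
    hφ.eq_zero _ fun h => ht ⟨by linarith [h.2], by linarith [h.1]⟩⟩

theorem IsProfile.conj {φ : ℝ → ℂ} (hφ : IsProfile φ) : IsProfile (fun t => conj (φ t)) :=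
  ⟨hφ.memLp.star, fun t ht => by simp [hφ.eq_zero t ht]⟩

theorem IsProfile.add {φ ψ : ℝ → ℂ} (hφ : IsProfile φ) (hψ : IsProfile ψ) :
    IsProfile (fun t => φ t + ψ t) :=
  ⟨hφ.memLp.add hψ.memLp, fun t ht => by simp [hφ.eq_zero t ht, hψ.eq_zero t ht]⟩

theorem IsProfile.const_mul {φ : ℝ → ℂ} (hφ : IsProfile φ) (k : ℂ) :
    IsProfile (fun t => k * φ t) :=
  ⟨hφ.memLp.const_mul k, fun t ht => by simp [hφ.eq_zero t ht]⟩

theorem IsProfile.integrable_mul_exp {φ : ℝ → ℂ} (hφ : IsProfile φ) (z : ℂ) :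
    Integrable fun t : ℝ => φ t * Complex.exp (-(2 * π * Complex.I * z * t)) := by
  refine Integrable.mono' (hφ.integrable.norm.mul_const (Real.exp (π * ‖z‖)))
    (hφ.integrable.aestronglyMeasurable.mul (by fun_prop)) (Eventually.of_forall fun t => ?_)
  rw [norm_mul]
  by_cases ht : t ∈ Set.Icc (-(1 / 2) : ℝ) (1 / 2)
  · gcongr
    exact norm_exp_le ht z
  · simp [hφ.eq_zero t ht]

theorem transform_add {φ ψ : ℝ → ℂ} (hφ : IsProfile φ) (hψ : IsProfile ψ) (z : ℂ) :
    transform (fun t => φ t + ψ t) z = transform φ z + transform ψ z := by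
  unfold transform
  rw [← integral_add (hφ.integrable_mul_exp z) (hψ.integrable_mul_exp z)]
  simp only [add_mul]

theorem transform_const_mul (φ : ℝ → ℂ) (k z : ℂ) :
    transform (fun t => k * φ t) z = k * transform φ z := by
  unfold transform
  rw [← integral_const_mul]
  simp only [mul_assoc]

theorem transform_reflect (φ : ℝ → ℂ) (z : ℂ) :
    transform (fun t => φ (-t)) z = transform φ (-z) := by
  unfold transform
  rw [← integral_neg_eq_self]
  simp

theorem transform_conj (φ : ℝ → ℂ) (z : ℂ) :
    transform (fun t => conj (φ t)) z = conj (transform φ (-conj z)) := by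
  unfold transform
  rw [← integral_conj]
  congr 1
  ext t
  rw [map_mul, ← Complex.exp_conj]
  simp [Complex.conj_ofNat]

theorem transform_conj_reflect (φ : ℝ → ℂ) (z : ℂ) :
    transform (fun t => conj (φ (-t))) z = conj (transform φ (conj z)) := by
  have := transform_conj (fun t => φ (-t)) z
  rw [this, transform_reflect, neg_neg]

/-- Plancherel's formula for band limited functions. -/
theorem integral_transform_mul_conj {φ ψ : ℝ → ℂ} (hφ : IsProfile φ) (hψ : IsProfile ψ) :
    ∫ x : ℝ, transform φ x * conj (transform ψ x) = ∫ t, φ t * conj (ψ t) := by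
  simp only [transform_ofReal]
  exact integral_conj_fourier_mul_fourier hφ.integrable hφ.memLp hψ.integrable hψ.memLp

theorem IsProfile.memLp_transform {φ : ℝ → ℂ} (hφ : IsProfile φ) :
    MemLp (fun x : ℝ => transform φ x) 2 := by
  simp only [transform_ofReal]
  exact memLp_fourier hφ.integrable hφ.memLp

theorem integrable_transform_mul_conj {φ ψ : ℝ → ℂ} (hφ : IsProfile φ) (hψ : IsProfile ψ) :
    Integrable fun x : ℝ => transform φ x * conj (transform ψ x) :=
  hφ.memLp_transform.integrable_mul hψ.memLp_transform.star

theorem integral_exp_mul_transform_mul_conj {φ ψ : ℝ → ℂ} (hφ : IsProfile φ) (hψ : IsProfile ψ)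
    (ξ : ℝ) :
    ∫ x : ℝ, Complex.exp ((-2 * π * x * ξ : ℝ) * Complex.I) *
      (transform φ x * conj (transform ψ x)) = ∫ t, φ (t - ξ) * conj (ψ t) := by
  have hshift : ∀ x : ℝ, 𝓕 (fun t => φ (t - ξ)) x =
      Complex.exp ((-2 * π * x * ξ : ℝ) * Complex.I) * transform φ x := by
    intro x
    rw [← transform_ofReal]
    unfold transform
    rw [← integral_add_right_eq_self _ ξ, ← integral_const_mul]
    congr 1
    ext t
    simp only [add_sub_cancel_right]
    rw [mul_left_comm, ← Complex.exp_add]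
    congr 2
    push_cast
    ring
  have hm : MemLp (fun t => φ (t - ξ)) 2 :=
    hφ.memLp.comp_measurePreserving (measurePreserving_sub_right volume ξ)
  rw [← integral_conj_fourier_mul_fourier (hφ.integrable.comp_sub_right ξ) hm
    hψ.integrable hψ.memLp]
  congr 1
  ext x
  rw [hshift, ← transform_ofReal, mul_assoc (Complex.exp _)]

theorem isAdmissible_of_eq_mul_conj {φ : ℝ → ℂ} (hφ : IsProfile φ) {R : ℂ → ℂ}
    (hR : Differentiable ℂ R) (h : ∀ x : ℝ, R x = transform φ x * conj (transform φ x)) :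
    IsAdmissible R := by
  refine ⟨hR, ?_, ?_⟩
  · simp only [h]
    exact integrable_transform_mul_conj hφ hφ
  · intro ξ hξ
    by_contra hout
    refine hξ ?_
    have hz : ∀ t, φ (t - ξ) * conj (φ t) = 0 := by
      intro t
      by_contra hne
      have h1 : t - ξ ∈ Set.Icc (-(1 / 2) : ℝ) (1 / 2) := by
        by_contra h1
        exact hne (by rw [hφ.eq_zero _ h1, zero_mul])
      have h2 : t ∈ Set.Icc (-(1 / 2) : ℝ) (1 / 2) := by
        by_contra h2
        exact hne (by rw [hφ.eq_zero _ h2, map_zero, mul_zero])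
      exact hout ⟨by linarith [h1.2, h2.1], by linarith [h1.1, h2.2]⟩
    rw [Real.fourier_real_eq_integral_exp_smul]
    simp only [h, smul_eq_mul]
    rw [integral_exp_mul_transform_mul_conj hφ hφ]
    simp only [hz, integral_zero]

theorem IsProfile.continuous_transform {φ : ℝ → ℂ} (hφ : IsProfile φ) :
    Continuous fun x : ℝ => transform φ x :=
  hφ.differentiable_transform.continuous.comp Complex.continuous_ofReal

/-- Entire functions that agree on the real line are equal. -/
theorem eq_of_eq_ofReal {G H : ℂ → ℂ} (hG : Differentiable ℂ G) (hH : Differentiable ℂ H)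
    (h : ∀ x : ℝ, G x = H x) : G = H := by
  refine AnalyticOnNhd.eq_of_frequently_eq (z₀ := 0)
    ((hG.differentiableOn (s := Set.univ)).analyticOnNhd isOpen_univ)
    ((hH.differentiableOn (s := Set.univ)).analyticOnNhd isOpen_univ) ?_
  have ht : Tendsto (fun x : ℝ => (x : ℂ)) (𝓝[≠] 0) (𝓝[≠] 0) := by
    refine tendsto_nhdsWithin_iff.2 ⟨?_, ?_⟩
    · exact (Complex.continuous_ofReal.tendsto' 0 0 rfl).mono_left nhdsWithin_le_nhds
    · filter_upwards [self_mem_nhdsWithin] with x hx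
      simpa using hx
  exact ht.frequently (Eventually.of_forall h).frequently

open Polynomial in
/-- The polynomial `z ↦ z ^ n * conj (p (1 / conj z))`. -/
noncomputable def conjReflect (n : ℕ) (p : ℂ[X]) : ℂ[X] := (p.map (starRingEnd ℂ)).reflect n

open Polynomial in
theorem eval_conjReflect {n : ℕ} {p : ℂ[X]} (hp : p.natDegree ≤ n) {z : ℂ} (hz : z ≠ 0) :
    (conjReflect n p).eval z = z ^ n * conj (p.eval (conj z)⁻¹) := by
  have hz' : z⁻¹ ≠ 0 := inv_ne_zero hz
  let _ : Invertible z⁻¹ := invertibleOfNonzero hz'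
  have key := eval₂_reflect_mul_pow (RingHom.id ℂ) z⁻¹ n (p.map (starRingEnd ℂ))
    (natDegree_map_le.trans hp)
  rw [invOf_eq_inv, inv_inv, eval₂_id, eval₂_id, inv_pow] at key
  have e : (p.map (starRingEnd ℂ)).eval z⁻¹ = conj (p.eval (conj z)⁻¹) := by
    have := Polynomial.eval_map_apply (f := starRingEnd ℂ) (p := p) (conj z)⁻¹
    rw [← this]
    simp
  rw [e] at key
  rw [← key, conjReflect]
  field_simp

open Polynomial in
theorem eval_conjReflect_of_norm_eq_one {n : ℕ} {p : ℂ[X]} (hp : p.natDegree ≤ n) {z : ℂ}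
    (hz : ‖z‖ = 1) : (conjReflect n p).eval z = z ^ n * conj (p.eval z) := by
  have hz0 : z ≠ 0 := by
    rintro rfl
    simp at hz
  rw [eval_conjReflect hp hz0, ← Complex.inv_eq_conj hz, inv_inv]

theorem infinite_norm_eq_one : {z : ℂ | ‖z‖ = 1}.Infinite := by
  have h : (Submonoid.unitSphere ℂ : Set ℂ) = {z : ℂ | ‖z‖ = 1} := by
    ext z
    simp [Submonoid.unitSphere]
  rw [← h]
  have : Infinite (Set.Ioc (-π) π) := (Set.Ioc_infinite (by linarith [Real.pi_pos])).to_subtype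
  exact Set.infinite_coe_iff.1
    (Infinite.of_injective Circle.argEquiv.symm Circle.argEquiv.symm.injective : Infinite Circle)

open Polynomial in
theorem eq_of_eval_eq_of_norm_eq_one {p r : ℂ[X]} (h : ∀ z : ℂ, ‖z‖ = 1 → p.eval z = r.eval z) :
    p = r :=
  eq_of_infinite_eval_eq p r (infinite_norm_eq_one.mono fun z hz => h z hz)

open Polynomial in
/-- The Fejér–Riesz theorem for trigonometric polynomials that are positive on the circle. -/
theorem exists_eval_eq_normSq (n : ℕ) : ∀ P : ℂ[X], P.natDegree ≤ 2 * n →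
    (∀ z : ℂ, ‖z‖ = 1 → ∃ r : ℝ, 0 < r ∧ P.eval z = z ^ n * r) →
    ∃ p : ℂ[X], p.natDegree ≤ n ∧
      ∀ z : ℂ, ‖z‖ = 1 → P.eval z = z ^ n * ((‖p.eval z‖ ^ 2 : ℝ) : ℂ) := by
  induction n with
  | zero =>
    intro P hdeg hpos
    have hC : P = C (P.coeff 0) := eq_C_of_natDegree_le_zero (by simpa using hdeg)
    obtain ⟨r, hr, hr1⟩ := hpos 1 (by simp)
    rw [hC] at hr1
    have hr2 : P.coeff 0 = r := by simpa using hr1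
    refine ⟨C (Real.sqrt r : ℂ), by simp, fun z _ => ?_⟩
    rw [hC, hr2]
    simp [abs_of_nonneg (Real.sqrt_nonneg r), Real.sq_sqrt hr.le]
  | succ n ih =>
    intro P hdeg hpos
    have hsymm : conjReflect (2 * (n + 1)) P = P := by
      refine eq_of_eval_eq_of_norm_eq_one fun z hz => ?_
      obtain ⟨r, -, hr⟩ := hpos z hz
      have hzz : z * conj z = 1 := by simp [Complex.mul_conj, Complex.normSq_eq_norm_sq, hz]
      rw [eval_conjReflect_of_norm_eq_one hdeg hz, hr, map_mul, map_pow, Complex.conj_ofReal,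
        two_mul, pow_add]
      calc z ^ (n + 1) * z ^ (n + 1) * ((conj z) ^ (n + 1) * r)
          = z ^ (n + 1) * (z * conj z) ^ (n + 1) * r := by rw [mul_pow]; ring
        _ = z ^ (n + 1) * r := by rw [hzz]; ring
    have hsymm_coeff : P.coeff (2 * (n + 1)) = conj (P.coeff 0) := by
      conv_lhs => rw [← hsymm]
      rw [conjReflect, coeff_reflect, revAt_le le_rfl, coeff_map, Nat.sub_self]
    by_cases h0 : P.coeff 0 = 0
    · obtain ⟨P₁, rfl⟩ := X_dvd_iff.2 h0
      by_cases hP₁ : P₁ = 0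
      · exfalso
        obtain ⟨r, hr, hr1⟩ := hpos 1 (by simp)
        simp [hP₁] at hr1
        exact hr.ne' (Complex.ofReal_eq_zero.1 hr1.symm)
      have hlt : (X * P₁).natDegree ≠ 2 * (n + 1) := by
        intro hEq
        rw [h0, map_zero, ← hEq] at hsymm_coeff
        exact (mul_ne_zero X_ne_zero hP₁) (leadingCoeff_eq_zero.1 hsymm_coeff)
      rw [natDegree_X_mul hP₁] at hdeg hlt
      obtain ⟨p, hp, hpe⟩ := ih P₁ (by omega) fun z hz => by
        obtain ⟨r, hr, hr1⟩ := hpos z hz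
        refine ⟨r, hr, ?_⟩
        have hz0 : z ≠ 0 := by
          rintro rfl
          simp at hz
        apply mul_left_cancel₀ hz0
        rw [eval_mul, eval_X] at hr1
        rw [hr1]
        ring
      refine ⟨p, by omega, fun z hz => ?_⟩
      rw [eval_mul, eval_X, hpe z hz]
      ring
    · have hdeg' : P.natDegree = 2 * (n + 1) := by
        refine le_antisymm hdeg (le_natDegree_of_ne_zero ?_)
        rw [hsymm_coeff]
        simpa using h0
      obtain ⟨α, hα⟩ := IsAlgClosed.exists_root P
        (by rw [Polynomial.degree_eq_natDegree (by rintro rfl; simp at h0), hdeg']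
            exact Nat.cast_ne_zero.2 (by omega))
      have hα' : P.eval α = 0 := hα
      have hα0 : α ≠ 0 := by
        rintro rfl
        rw [← coeff_zero_eq_eval_zero] at hα'
        exact h0 hα'
      have hα1 : ∀ z : ℂ, ‖z‖ = 1 → z ≠ α := by
        rintro z hz rfl
        obtain ⟨r, hr, hr1⟩ := hpos z hz
        rw [hα'] at hr1
        have := mul_ne_zero (pow_ne_zero (n + 1) hα0) (Complex.ofReal_ne_zero.2 hr.ne')
        exact this hr1.symm
      have hβ : P.eval (conj α)⁻¹ = 0 := by
        have hne : (conj α)⁻¹ ≠ 0 := by simpa using hα0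
        rw [← hsymm, eval_conjReflect hdeg hne]
        simp [hα']
      obtain ⟨P₁, hP₁⟩ := dvd_iff_isRoot.2 hα
      have hαβ : (conj α)⁻¹ - α ≠ 0 := by
        intro h
        have h1 : α * conj α = 1 := by
          have h2 : α = (conj α)⁻¹ := (sub_eq_zero.1 h).symm
          nth_rw 1 [h2]
          exact inv_mul_cancel₀ (by simpa using hα0)
        rw [Complex.mul_conj, Complex.normSq_eq_norm_sq] at h1
        have h3 : ‖α‖ ^ 2 = 1 := by exact_mod_cast h1
        have h4 : ‖α‖ = 1 := by
          exact (pow_eq_one_iff_of_nonneg (norm_nonneg α) two_ne_zero).1 h3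
        exact hα1 α h4 rfl
      have hβ₁ : P₁.IsRoot (conj α)⁻¹ := by
        rw [hP₁, eval_mul] at hβ
        simp only [eval_sub, eval_X, eval_C] at hβ
        exact (mul_eq_zero.1 hβ).resolve_left hαβ
      obtain ⟨P₂, hP₂⟩ := dvd_iff_isRoot.2 hβ₁
      have hP₂0 : P₂ ≠ 0 := by
        rintro rfl
        rw [hP₁, hP₂] at h0
        simp at h0
      have hdeg₂ : P₂.natDegree = 2 * n := by
        rw [hP₁, hP₂, natDegree_mul (X_sub_C_ne_zero _) (mul_ne_zero (X_sub_C_ne_zero _) hP₂0),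
          natDegree_mul (X_sub_C_ne_zero _) hP₂0, natDegree_X_sub_C, natDegree_X_sub_C] at hdeg'
        omega
      have hfactor : ∀ z : ℂ, ‖z‖ = 1 → P.eval z =
          z * ((‖z - α‖ ^ 2 : ℝ) : ℂ) * (C (-(conj α)⁻¹) * P₂).eval z := by
        intro z hz
        have hzz : z * conj z = 1 := by simp [Complex.mul_conj, Complex.normSq_eq_norm_sq, hz]
        have hsq : ((‖z - α‖ ^ 2 : ℝ) : ℂ) = (z - α) * conj (z - α) := by
          rw [Complex.mul_conj, Complex.normSq_eq_norm_sq]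
        rw [hsq, hP₁, hP₂]
        simp only [eval_mul, eval_sub, eval_X, eval_C, map_sub]
        have hc : conj α ≠ 0 := by simpa using hα0
        field_simp
        linear_combination (z - α) * (eval z P₂) * hzz
      obtain ⟨p, hp, hpe⟩ := ih (C (-(conj α)⁻¹) * P₂)
        ((natDegree_C_mul_le _ _).trans hdeg₂.le) fun z hz => by
          obtain ⟨r, hr, hr1⟩ := hpos z hz
          have hn : 0 < ‖z - α‖ := norm_pos_iff.2 (sub_ne_zero.2 (hα1 z hz))
          refine ⟨r / ‖z - α‖ ^ 2, by positivity, ?_⟩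
          have hz0 : z ≠ 0 := by
            rintro rfl
            simp at hz
          have hn' : ((‖z - α‖ ^ 2 : ℝ) : ℂ) ≠ 0 := by exact_mod_cast (pow_pos hn 2).ne'
          apply mul_left_cancel₀ (mul_ne_zero hz0 hn')
          rw [← hfactor z hz, hr1, Complex.ofReal_div]
          field_simp
          ring
      refine ⟨(X - C α) * p, ?_, fun z hz => ?_⟩
      · refine natDegree_mul_le.trans ?_
        rw [natDegree_X_sub_C]
        omega
      · rw [hfactor z hz, hpe z hz, eval_mul, norm_mul]
        simp only [eval_sub, eval_X, eval_C]
        push_cast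
        ring

open Polynomial in
theorem coeff_eq_sum_normSq {n : ℕ} {P p : ℂ[X]} (hp : p.natDegree ≤ n)
    (h : ∀ z : ℂ, ‖z‖ = 1 → P.eval z = z ^ n * ((‖p.eval z‖ ^ 2 : ℝ) : ℂ)) :
    P.coeff n = ∑ j ∈ Finset.range (n + 1), ((‖p.coeff j‖ ^ 2 : ℝ) : ℂ) := by
  have hP : P = p * conjReflect n p := by
    refine eq_of_eval_eq_of_norm_eq_one fun z hz => ?_
    rw [h z hz, eval_mul, eval_conjReflect_of_norm_eq_one hp hz, ← Complex.normSq_eq_norm_sq,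
      ← Complex.mul_conj]
    ring
  rw [hP, coeff_mul, Finset.Nat.sum_antidiagonal_eq_sum_range_succ_mk]
  refine Finset.sum_congr rfl fun j hj => ?_
  have hj' : j ≤ n := by
    rw [Finset.mem_range] at hj
    omega
  rw [conjReflect, coeff_reflect, revAt_le (Nat.sub_le _ _), coeff_map, Nat.sub_sub_self hj',
    Complex.mul_conj, Complex.normSq_eq_norm_sq]

/-- The sum of `G m` over `|m| ≤ n`. -/
def symmSum (G : ℤ → ℂ) (n : ℕ) : ℂ :=
  G 0 + ∑ i ∈ Finset.range n, (G ((i : ℤ) + 1) + G (-((i : ℤ) + 1)))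

theorem symmSum_eq_sum_range (G : ℤ → ℂ) (n : ℕ) :
    symmSum G n = ∑ k ∈ Finset.range (2 * n + 1), G ((k : ℤ) - n) := by
  induction n with
  | zero => simp [symmSum]
  | succ n ih =>
    have h : symmSum G (n + 1) = symmSum G n + (G ((n : ℤ) + 1) + G (-((n : ℤ) + 1))) := by
      unfold symmSum
      rw [Finset.sum_range_succ]
      ring
    rw [h, ih, show 2 * (n + 1) + 1 = (2 * n + 1 + 1) + 1 by ring,
      Finset.sum_range_succ' _ (2 * n + 1 + 1), Finset.sum_range_succ _ (2 * n + 1)]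
    have e1 : ∀ k : ℕ, (((k + 1 : ℕ) : ℤ) - ((n + 1 : ℕ) : ℤ)) = (k : ℤ) - n := by
      intro k
      push_cast
      ring
    simp only [e1]
    have e2 : (((2 * n + 1 : ℕ) : ℤ) - (n : ℤ)) = n + 1 := by
      push_cast
      ring
    have e3 : (((0 : ℕ) : ℤ) - ((n + 1 : ℕ) : ℤ)) = -((n : ℤ) + 1) := by
      push_cast
      ring
    rw [e2, e3]
    ring

theorem toeplitz_sum_succ (G : ℤ → ℂ) (m : ℕ) :
    ∑ j ∈ Finset.range (m + 1), ∑ l ∈ Finset.range (m + 1), G ((j : ℤ) - l) =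
      ∑ j ∈ Finset.range m, ∑ l ∈ Finset.range m, G ((j : ℤ) - l) + symmSum G m := by
  rw [Finset.sum_range_succ]
  simp only [Finset.sum_range_succ (fun l => G (_ - ((l : ℕ) : ℤ)))]
  rw [Finset.sum_add_distrib, symmSum, Finset.sum_add_distrib, sub_self]
  have h1 : ∑ j ∈ Finset.range m, G ((j : ℤ) - m) =
      ∑ i ∈ Finset.range m, G (-((i : ℤ) + 1)) := by
    rw [← Finset.sum_range_reflect]
    refine Finset.sum_congr rfl fun j hj => ?_
    rw [Finset.mem_range] at hj
    congr 1
    omega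
  have h2 : ∑ l ∈ Finset.range m, G ((m : ℤ) - l) =
      ∑ i ∈ Finset.range m, G ((i : ℤ) + 1) := by
    rw [← Finset.sum_range_reflect]
    refine Finset.sum_congr rfl fun j hj => ?_
    rw [Finset.mem_range] at hj
    congr 1
    omega
  rw [h1, h2]
  ring

theorem toeplitz_sum_eq {G : ℤ → ℂ} {n : ℕ} (hG : ∀ m : ℤ, n < m.natAbs → G m = 0) (k : ℕ) :
    ∑ j ∈ Finset.range (n + k), ∑ l ∈ Finset.range (n + k), G ((j : ℤ) - l) =
      ∑ j ∈ Finset.range n, ∑ l ∈ Finset.range n, G ((j : ℤ) - l) + k * symmSum G n := by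
  induction k with
  | zero => simp
  | succ k ih =>
    have h : symmSum G (n + k) = symmSum G n := by
      unfold symmSum
      congr 1
      symm
      refine Finset.sum_subset (by simp) fun i _ hi => ?_
      rw [Finset.mem_range, not_lt] at hi
      rw [hG _ (by omega), hG _ (by omega), add_zero]
    rw [← add_assoc, toeplitz_sum_succ, ih, h]
    push_cast
    ring

theorem exists_symmSum_eq_of_toeplitz_nonneg {G : ℤ → ℂ} {n : ℕ}
    (hG : ∀ m : ℤ, n < m.natAbs → G m = 0)
    (hpos : ∀ m : ℕ, ∃ δ : ℝ, 0 ≤ δ ∧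
      ∑ j ∈ Finset.range m, ∑ l ∈ Finset.range m, G ((j : ℤ) - l) = δ) :
    ∃ s : ℝ, 0 ≤ s ∧ symmSum G n = s := by
  obtain ⟨δ₀, -, h₀⟩ := hpos n
  obtain ⟨δ₁, -, h₁⟩ := hpos (n + 1)
  have hs : symmSum G n = ((δ₁ - δ₀ : ℝ) : ℂ) := by
    have := toeplitz_sum_eq hG 1
    rw [h₀, h₁] at this
    push_cast at this ⊢
    linear_combination -this
  refine ⟨δ₁ - δ₀, ?_, hs⟩
  by_contra hneg
  obtain ⟨k, hk⟩ := exists_nat_gt (δ₀ / (-(δ₁ - δ₀)))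
  obtain ⟨δ₂, hδ₂, h₂⟩ := hpos (n + k)
  rw [toeplitz_sum_eq hG, h₀, hs] at h₂
  have h₃ : δ₀ + k * (δ₁ - δ₀) = δ₂ := by exact_mod_cast h₂
  rw [not_le] at hneg
  rw [div_lt_iff₀ (by linarith)] at hk
  linarith

theorem integrable_exp_mul {u : ℝ → ℂ} (hu : Integrable u) (w : ℝ) :
    Integrable fun y : ℝ => Complex.exp ((-2 * π * (y * w) : ℝ) * Complex.I) * u y := by
  refine Integrable.bdd_mul (c := 1) hu (by fun_prop) (Eventually.of_forall fun y => ?_)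
  rw [Complex.norm_exp_ofReal_mul_I]

/-- The Fourier transform of a nonnegative function is positive definite. -/
theorem toeplitz_fourier_nonneg {u : ℝ → ℂ} (hu : Integrable u) {r : ℝ → ℝ}
    (hr : ∀ y, 0 ≤ r y) (hur : ∀ y, u y = r y) (N : ℝ) {z : ℂ} (hz : ‖z‖ = 1) (m : ℕ) :
    ∃ δ : ℝ, 0 ≤ δ ∧ ∑ j ∈ Finset.range m, ∑ l ∈ Finset.range m,
      𝓕 u ((((j : ℤ) - l : ℤ) : ℝ) / N) * z ^ ((j : ℤ) - l) = δ := by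
  have hz0 : z ≠ 0 := by
    rintro rfl
    simp at hz
  let E : ℝ → ℂ := fun y => ∑ j ∈ Finset.range m,
    z ^ j * Complex.exp ((-2 * π * (y * (j / N)) : ℝ) * Complex.I)
  refine ⟨∫ y, r y * ‖E y‖ ^ 2, integral_nonneg fun y => mul_nonneg (hr y) (by positivity), ?_⟩
  have hE : ∀ y, ((r y * ‖E y‖ ^ 2 : ℝ) : ℂ) = ∑ j ∈ Finset.range m, ∑ l ∈ Finset.range m,
      (Complex.exp ((-2 * π * (y * ((((j : ℤ) - l : ℤ) : ℝ) / N)) : ℝ) * Complex.I) * u y) *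
        z ^ ((j : ℤ) - l) := by
    intro y
    rw [Complex.ofReal_mul, Complex.ofReal_pow, ← Complex.mul_conj', hur]
    simp only [E]
    rw [map_sum, Finset.sum_mul_sum, Finset.mul_sum]
    refine Finset.sum_congr rfl fun j _ => ?_
    rw [Finset.mul_sum]
    refine Finset.sum_congr rfl fun l _ => ?_
    rw [map_mul, map_pow, ← Complex.exp_conj, map_mul, Complex.conj_ofReal, Complex.conj_I,
      ← Complex.inv_eq_conj hz, zpow_sub₀ hz0, zpow_natCast, zpow_natCast]
    have : Complex.exp ((-2 * π * (y * ((((j : ℤ) - l : ℤ) : ℝ) / N)) : ℝ) * Complex.I) =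
        Complex.exp ((-2 * π * (y * (j / N)) : ℝ) * Complex.I) *
          Complex.exp ((-2 * π * (y * (l / N)) : ℝ) * -Complex.I) := by
      rw [← Complex.exp_add]
      congr 1
      push_cast
      ring
    rw [this, inv_pow]
    field_simp
  rw [← integral_complex_ofReal]
  simp only [hE]
  rw [integral_finsetSum _ fun j _ => integrable_finsetSum _ fun l _ =>
    (integrable_exp_mul hu _).mul_const _]
  refine Finset.sum_congr rfl fun j _ => ?_
  rw [integral_finsetSum _ fun l _ => (integrable_exp_mul hu _).mul_const _]
  refine Finset.sum_congr rfl fun l _ => ?_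
  rw [integral_mul_const, Real.fourier_real_eq_integral_exp_smul]
  simp only [smul_eq_mul, mul_assoc]

/-- Convergence of Riemann sums of a continuous function that vanishes outside `(-1, 1)`. -/
theorem tendsto_riemann_sum {H : ℝ → ℂ} (hH : Continuous H) (h0 : ∀ t, 1 ≤ |t| → H t = 0) :
    Tendsto (fun n : ℕ => (1 / ((n : ℂ) + 1)) *
      ∑ k ∈ Finset.range (2 * n + 1), H ((((k : ℤ) - n : ℤ) : ℝ) / ((n : ℝ) + 1)))
      atTop (𝓝 (∫ t, H t)) := by
  have hsupp : HasCompactSupport H := by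
    refine HasCompactSupport.intro (isCompact_Icc (a := (-1 : ℝ)) (b := 1)) fun t ht => h0 t ?_
    by_contra h
    rw [not_le, abs_lt] at h
    exact ht ⟨h.1.le, h.2.le⟩
  have huc : UniformContinuous H := hsupp.uniformContinuous_of_continuous hH
  have hint : ∫ t, H t = ∫ t in (-1 : ℝ)..1, H t := by
    rw [intervalIntegral.integral_of_le (by norm_num), ← integral_Icc_eq_integral_Ioc]
    symm
    refine setIntegral_eq_integral_of_forall_compl_eq_zero fun t ht => h0 t ?_
    by_contra h
    rw [not_le, abs_lt] at h
    exact ht ⟨h.1.le, h.2.le⟩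
  rw [hint, Metric.tendsto_atTop]
  intro ε hε
  obtain ⟨δ, hδ, hδH⟩ := Metric.uniformContinuous_iff.1 huc (ε / 4) (by positivity)
  obtain ⟨n₀, hn₀⟩ := exists_nat_gt (1 / δ)
  refine ⟨n₀, fun n hn => ?_⟩
  have hn1 : (0 : ℝ) < (n : ℝ) + 1 := by positivity
  have hnδ : 1 / ((n : ℝ) + 1) < δ := by
    rw [div_lt_iff₀ hn1]
    rw [div_lt_iff₀ hδ] at hn₀
    have : (n₀ : ℝ) ≤ n := by exact_mod_cast hn
    nlinarith
  let s : ℕ → ℝ := fun k => ((k : ℝ) - (n + 1)) / ((n : ℝ) + 1)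
  have hs : ∀ k, s (k + 1) - s k = 1 / ((n : ℝ) + 1) := by
    intro k
    simp only [s]
    push_cast
    ring
  have hs' : ∀ k, s k ≤ s (k + 1) := fun k => by
    have := hs k
    have : 0 < 1 / ((n : ℝ) + 1) := by positivity
    linarith
  have hsum : ∑ k ∈ Finset.range (2 * n + 1), H ((((k : ℤ) - n : ℤ) : ℝ) / ((n : ℝ) + 1)) =
      ∑ k ∈ Finset.range (2 * n + 2), H (s k) := by
    rw [Finset.sum_range_succ' _ (2 * n + 1)]
    have : H (s 0) = 0 := h0 _ (by
      have : s 0 = -1 := by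
        simp only [s]
        push_cast
        field_simp
        ring
      rw [this]
      norm_num)
    rw [this, add_zero]
    refine Finset.sum_congr rfl fun k _ => ?_
    congr 1
    simp only [s]
    push_cast
    ring
  have hI : ∫ t in (-1 : ℝ)..1, H t =
      ∑ k ∈ Finset.range (2 * n + 2), ∫ t in (s k)..(s (k + 1)), H t := by
    rw [intervalIntegral.sum_integral_adjacent_intervals fun k _ => hH.intervalIntegrable _ _]
    congr 1
    · simp only [s]
      push_cast
      field_simp
      ring
    · simp only [s]
      push_cast
      field_simp
      ring
  rw [hsum, hI, Finset.mul_sum, dist_eq_norm, ← Finset.sum_sub_distrib]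
  have hterm : ∀ k ∈ Finset.range (2 * n + 2),
      ‖1 / ((n : ℂ) + 1) * H (s k) - ∫ t in (s k)..(s (k + 1)), H t‖ ≤
        ε / 4 * (1 / ((n : ℝ) + 1)) := by
    intro k _
    have hc : 1 / ((n : ℂ) + 1) * H (s k) = ∫ t in (s k)..(s (k + 1)), H (s k) := by
      rw [intervalIntegral.integral_const, hs, Complex.real_smul]
      push_cast
      ring
    rw [hc, ← intervalIntegral.integral_sub (by simp) (hH.intervalIntegrable _ _)]
    refine (intervalIntegral.norm_integral_le_of_norm_le_const (C := ε / 4)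
      fun t ht => ?_).trans ?_
    · rw [Set.uIoc_of_le (hs' k)] at ht
      rw [← dist_eq_norm]
      refine (hδH ?_).le
      rw [Real.dist_eq, abs_sub_comm, abs_of_nonneg (by linarith [ht.1])]
      linarith [ht.2, hs k]
    · rw [hs, abs_of_nonneg (by positivity)]
  refine (norm_sum_le_of_le _ hterm).trans_lt ?_
  rw [Finset.sum_const, Finset.card_range, nsmul_eq_mul]
  push_cast
  have : (2 * (n : ℝ) + 2) * (ε / 4 * (1 / ((n : ℝ) + 1))) = ε / 2 := by
    field_simp
    ring
  rw [this]
  linarith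

/-- The integral of a function given piecewise on the intervals of a uniform partition of
`[-1/2, 1/2]`. -/
theorem integral_piecewise_floor {E : Type*} [NormedAddCommGroup E] [NormedSpace ℝ E]
    (n : ℕ) (ψ : ℕ → ℝ → E) (hψ : ∀ j, Continuous (ψ j)) :
    ∫ t in Set.Ico (-(1 / 2) : ℝ) (1 / 2), ψ ⌊((n : ℝ) + 1) * (t + 1 / 2)⌋₊ t =
      ∑ j ∈ Finset.range (n + 1),
        ∫ t in ((j : ℝ) / (n + 1) - 1 / 2)..(((j + 1 : ℕ) : ℝ) / (n + 1) - 1 / 2), ψ j t := by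
  have hn : (0 : ℝ) < (n : ℝ) + 1 := by positivity
  let s : ℕ → ℝ := fun j => (j : ℝ) / (n + 1) - 1 / 2
  have hs : ∀ j, s j < s (j + 1) := fun j => by
    simp only [s]
    gcongr
    simp
  have heq : ∀ j, ∀ t ∈ Set.Ioo (s j) (s (j + 1)),
      ψ j t = ψ ⌊((n : ℝ) + 1) * (t + 1 / 2)⌋₊ t := by
    intro j t ht
    have h1 : (j : ℝ) / (n + 1) < t + 1 / 2 := by
      have := ht.1
      simp only [s] at this
      linarith
    have h2 : t + 1 / 2 < ((j + 1 : ℕ) : ℝ) / (n + 1) := by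
      have := ht.2
      simp only [s] at this
      linarith
    rw [div_lt_iff₀ hn] at h1
    rw [lt_div_iff₀ hn] at h2
    push_cast at h2
    have : ⌊((n : ℝ) + 1) * (t + 1 / 2)⌋₊ = j := by
      rw [Nat.floor_eq_iff (by nlinarith [(Nat.cast_nonneg j : (0 : ℝ) ≤ j)])]
      constructor <;> linarith
    rw [this]
  have hae : ∀ j, ∀ᵐ t ∂(volume : Measure ℝ), t ∈ Set.uIoc (s j) (s (j + 1)) →
      ψ j t = ψ ⌊((n : ℝ) + 1) * (t + 1 / 2)⌋₊ t := by
    intro j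
    have hne : ∀ᵐ t ∂(volume : Measure ℝ), t ≠ s (j + 1) :=
      (measure_eq_zero_iff_ae_notMem.1 Real.volume_singleton).mono fun t ht => ht
    filter_upwards [hne] with t ht ht'
    rw [Set.uIoc_of_le (hs j).le] at ht'
    exact heq j t ⟨ht'.1, lt_of_le_of_ne ht'.2 ht⟩
  have hint : ∀ j, IntervalIntegrable (fun t => ψ ⌊((n : ℝ) + 1) * (t + 1 / 2)⌋₊ t) volume
      (s j) (s (j + 1)) := fun j =>
    ((hψ j).intervalIntegrable _ _).congr_ae
      ((ae_restrict_iff' measurableSet_uIoc).2 (hae j))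
  have h0 : s 0 = -(1 / 2) := by simp [s]
  have h1 : s (n + 1) = 1 / 2 := by
    simp only [s]
    push_cast
    field_simp
    norm_num
  rw [integral_Ico_eq_integral_Ioo, ← integral_Ioc_eq_integral_Ioo,
    ← intervalIntegral.integral_of_le (by norm_num)]
  have hsum := intervalIntegral.sum_integral_adjacent_intervals (n := n + 1) fun k _ => hint k
  rw [h0, h1] at hsum
  rw [← hsum]
  exact Finset.sum_congr rfl fun j _ => (intervalIntegral.integral_congr_ae (hae j)).symm

/-- The step function with the values `(n + 1) * v j` on a uniform partition of `[-1/2, 1/2)`. -/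
noncomputable def stepFun (n : ℕ) (v : ℕ → ℂ) : ℝ → ℂ :=
  Set.indicator (Set.Ico (-(1 / 2) : ℝ) (1 / 2))
    fun t => ((n : ℂ) + 1) * v ⌊((n : ℝ) + 1) * (t + 1 / 2)⌋₊

theorem isProfile_stepFun (n : ℕ) (v : ℕ → ℂ) : IsProfile (stepFun n v) := by
  refine ⟨?_, fun t ht => Set.indicator_of_notMem (fun h => ht ⟨h.1, h.2.le⟩) _⟩
  rw [stepFun, memLp_indicator_iff_restrict measurableSet_Ico]
  refine MemLp.of_bound (C := ((n : ℝ) + 1) * ∑ j ∈ Finset.range (n + 1), ‖v j‖)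
    (Measurable.aestronglyMeasurable ?_) (hfC := ?_)
  · exact ((measurable_from_nat (f := v)).comp (Nat.measurable_floor.comp
      (by fun_prop : Measurable fun t : ℝ => ((n : ℝ) + 1) * (t + 1 / 2)))).const_mul _
  · refine (ae_restrict_iff' measurableSet_Ico).2 (Eventually.of_forall fun t ht => ?_)
    rw [norm_mul]
    have hn : ‖(n : ℂ) + 1‖ = (n : ℝ) + 1 := by
      rw [← Nat.cast_add_one, Complex.norm_natCast]
      push_cast
      rfl
    rw [hn]
    gcongr
    refine Finset.single_le_sum (f := fun j => ‖v j‖) (fun _ _ => norm_nonneg _) ?_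
    rw [Finset.mem_range, Nat.floor_lt (by
      have := ht.1
      have : (0 : ℝ) ≤ t + 1 / 2 := by linarith
      positivity)]
    push_cast
    have := ht.2
    nlinarith [(Nat.cast_nonneg n : (0 : ℝ) ≤ n)]

theorem integral_normSq_stepFun (n : ℕ) (v : ℕ → ℂ) :
    ∫ t, ‖stepFun n v t‖ ^ 2 = ((n : ℝ) + 1) * ∑ j ∈ Finset.range (n + 1), ‖v j‖ ^ 2 := by
  have h : ∀ t, ‖stepFun n v t‖ ^ 2 = Set.indicator (Set.Ico (-(1 / 2) : ℝ) (1 / 2))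
      (fun t => ((n : ℝ) + 1) ^ 2 * ‖v ⌊((n : ℝ) + 1) * (t + 1 / 2)⌋₊‖ ^ 2) t := by
    intro t
    have hn : ‖(n : ℂ) + 1‖ = (n : ℝ) + 1 := by
      rw [← Nat.cast_add_one, Complex.norm_natCast]
      push_cast
      rfl
    by_cases ht : t ∈ Set.Ico (-(1 / 2) : ℝ) (1 / 2)
    · rw [stepFun, Set.indicator_of_mem ht, Set.indicator_of_mem ht, norm_mul, hn, mul_pow]
    · rw [stepFun, Set.indicator_of_notMem ht, Set.indicator_of_notMem ht]
      simp
  simp only [h]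
  rw [integral_indicator measurableSet_Ico,
    integral_piecewise_floor n (fun j _ => ((n : ℝ) + 1) ^ 2 * ‖v j‖ ^ 2)
      fun j => continuous_const, Finset.mul_sum]
  refine Finset.sum_congr rfl fun j _ => ?_
  rw [intervalIntegral.integral_const, smul_eq_mul]
  push_cast
  have hn : (n : ℝ) + 1 ≠ 0 := by positivity
  field_simp
  ring

theorem transform_stepFun (n : ℕ) (v : ℕ → ℂ) (x : ℝ) :
    transform (stepFun n v) x =
      (((n : ℂ) + 1) * ∫ t in (0 : ℝ)..1 / ((n : ℝ) + 1),
        Complex.exp (-(2 * π * Complex.I * x * t))) * Complex.exp (π * Complex.I * x) *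
      ∑ j ∈ Finset.range (n + 1),
        v j * Complex.exp (-(2 * π * Complex.I * x / ((n : ℂ) + 1))) ^ j := by
  have h : ∀ t : ℝ, stepFun n v t * Complex.exp (-(2 * π * Complex.I * x * t)) =
      Set.indicator (Set.Ico (-(1 / 2) : ℝ) (1 / 2))
        (fun t => (((n : ℂ) + 1) * v ⌊((n : ℝ) + 1) * (t + 1 / 2)⌋₊) *
          Complex.exp (-(2 * π * Complex.I * x * t))) t := by
    intro t
    rw [stepFun]
    by_cases ht : t ∈ Set.Ico (-(1 / 2) : ℝ) (1 / 2)
    · rw [Set.indicator_of_mem ht, Set.indicator_of_mem ht]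
    · rw [Set.indicator_of_notMem ht, Set.indicator_of_notMem ht, zero_mul]
  unfold transform
  simp only [h]
  rw [integral_indicator measurableSet_Ico,
    integral_piecewise_floor n (fun j t => (((n : ℂ) + 1) * v j) *
          Complex.exp (-(2 * π * Complex.I * x * t)))
      fun j => by fun_prop, Finset.mul_sum]
  refine Finset.sum_congr rfl fun j _ => ?_
  have hn : (n : ℝ) + 1 ≠ 0 := by positivity
  have e1 : (((j + 1 : ℕ) : ℝ) / (n + 1) - 1 / 2) =
      ((j : ℝ) / (n + 1) - 1 / 2) + 1 / ((n : ℝ) + 1) := by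
    push_cast
    ring
  have e2 := intervalIntegral.integral_comp_add_left (a := 0) (b := 1 / ((n : ℝ) + 1))
    (fun t : ℝ => Complex.exp (-(2 * π * Complex.I * x * t))) ((j : ℝ) / (n + 1) - 1 / 2)
  rw [add_zero] at e2
  rw [intervalIntegral.integral_const_mul, e1, ← e2]
  have e3 : ∀ t : ℝ, Complex.exp (-(2 * π * Complex.I * x *
      (((j : ℝ) / (n + 1) - 1 / 2 + t : ℝ) : ℂ))) =
      (Complex.exp (π * Complex.I * x) *
        Complex.exp (-(2 * π * Complex.I * x / ((n : ℂ) + 1))) ^ j) *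
        Complex.exp (-(2 * π * Complex.I * x * t)) := by
    intro t
    rw [← Complex.exp_nat_mul, ← Complex.exp_add, ← Complex.exp_add]
    congr 1
    push_cast
    ring
  simp only [e3]
  rw [intervalIntegral.integral_const_mul]
  ring

theorem tendsto_average_exp (x : ℝ) :
    Tendsto (fun n : ℕ => ((n : ℂ) + 1) * ∫ t in (0 : ℝ)..1 / ((n : ℝ) + 1),
        Complex.exp (-(2 * π * Complex.I * x * t))) atTop (𝓝 1) := by
  have hc : Continuous fun t : ℝ => Complex.exp (-(2 * π * Complex.I * x * t)) := by fun_prop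
  have hd := (hc.integral_hasStrictDerivAt 0 0).hasDerivAt.tendsto_slope_zero_right
  have ht : Tendsto (fun n : ℕ => 1 / ((n : ℝ) + 1)) atTop (𝓝[>] 0) :=
    tendsto_nhdsWithin_iff.2 ⟨tendsto_one_div_add_atTop_nhds_zero_nat,
      Eventually.of_forall fun n => by
        rw [Set.mem_Ioi]
        positivity⟩
  have := hd.comp ht
  simp only [Complex.ofReal_zero, mul_zero, neg_zero, Complex.exp_zero] at this
  refine this.congr fun n => ?_
  simp [Complex.real_smul]

/-- Weak compactness of bounded sets of a Hilbert space. -/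
theorem exists_tendsto_inner {H : Type*} [NormedAddCommGroup H] [InnerProductSpace ℂ H]
    [CompleteSpace H] {v : ℕ → H} {C : ℝ} (hv : ∀ n, ‖v n‖ ≤ C) (U : Ultrafilter ℕ) :
    ∃ w : H, ∀ u : H, Tendsto (fun n => inner ℂ (v n) u) U (𝓝 (inner ℂ w u)) := by
  let D : ℕ → WeakDual ℂ H := fun n => StrongDual.toWeakDual (InnerProductSpace.toDual ℂ H (v n))
  have hmem : ∀ n, D n ∈ WeakDual.toStrongDual ⁻¹' Metric.closedBall (0 : StrongDual ℂ H) C := by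
    intro n
    rw [Set.mem_preimage, Metric.mem_closedBall, dist_zero_right]
    exact ((InnerProductSpace.toDual ℂ H).norm_map (v n)).le.trans (hv n)
  obtain ⟨T, -, hT⟩ := (WeakDual.isCompact_closedBall (𝕜 := ℂ) (E := H) 0 C).ultrafilter_le_nhds
    (U.map D) (le_principal_iff.2 (Filter.Eventually.of_forall (f := (U : Filter ℕ)) hmem))
  refine ⟨(InnerProductSpace.toDual ℂ H).symm (WeakDual.toStrongDual T), fun u => ?_⟩
  have h1 := ((WeakDual.eval_continuous u).tendsto T).comp (show Tendsto D U (𝓝 T) from hT)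
  have h2 : T u = inner ℂ ((InnerProductSpace.toDual ℂ H).symm (WeakDual.toStrongDual T)) u := by
    rw [← InnerProductSpace.toDual_apply_apply, LinearIsometryEquiv.apply_symm_apply]
    rfl
  rw [h2] at h1
  exact h1

/-- Weak compactness of bounded sets of profiles. -/
theorem exists_tendsto_transform {φ : ℕ → ℝ → ℂ} (hφ : ∀ n, IsProfile (φ n)) {C : ℝ}
    (hC : ∀ n, ∫ t, ‖φ n t‖ ^ 2 ≤ C) (U : Ultrafilter ℕ) :
    ∃ ψ : ℝ → ℂ, IsProfile ψ ∧
      ∀ z, Tendsto (fun n => transform (φ n) z) U (𝓝 (transform ψ z)) := by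
  let v : ℕ → Lp ℂ 2 (volume : Measure ℝ) := fun n => (hφ n).memLp.toLp (φ n)
  have hv : ∀ n, ‖v n‖ ≤ Real.sqrt C := by
    intro n
    refine Real.le_sqrt_of_sq_le ?_
    refine le_trans (le_of_eq ?_) (hC n)
    have h1 : ((‖v n‖ ^ 2 : ℝ) : ℂ) = inner ℂ (v n) (v n) := by
      rw [inner_self_eq_norm_sq_to_K]
      push_cast
      rfl
    rw [← Complex.ofReal_inj, h1, L2.inner_def, ← integral_complex_ofReal]
    refine integral_congr_ae ?_
    filter_upwards [(hφ n).memLp.coeFn_toLp] with t ht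
    simp only [v, ht]
    rw [inner_self_eq_norm_sq_to_K]
    push_cast
    rfl
  obtain ⟨w, hw⟩ := exists_tendsto_inner hv U
  refine ⟨Set.indicator (Set.Icc (-(1 / 2) : ℝ) (1 / 2)) w,
    ⟨(Lp.memLp w).indicator measurableSet_Icc, fun t ht => Set.indicator_of_notMem ht _⟩,
    fun z => ?_⟩
  let e : ℝ → ℂ := Set.indicator (Set.Icc (-(1 / 2) : ℝ) (1 / 2))
    fun t => conj (Complex.exp (-(2 * π * Complex.I * z * t)))
  have he : MemLp e 2 := by
    rw [memLp_indicator_iff_restrict measurableSet_Icc]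
    refine MemLp.of_bound (C := Real.exp (π * ‖z‖)) (Continuous.aestronglyMeasurable ?_) (hfC := ?_)
    · exact Complex.continuous_conj.comp (by fun_prop)
    · refine (ae_restrict_iff' measurableSet_Icc).2 (Eventually.of_forall fun t ht => ?_)
      rw [RCLike.norm_conj]
      exact norm_exp_le ht z
  have h := (hw (he.toLp e)).star
  have e1 : ∀ n, star (inner ℂ (v n) (he.toLp e)) = transform (φ n) z := by
    intro n
    rw [Complex.star_def, inner_conj_symm, L2.inner_def, transform]
    refine integral_congr_ae ?_
    filter_upwards [(hφ n).memLp.coeFn_toLp, he.coeFn_toLp] with t h1 h2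
    simp only [v, h1, h2, RCLike.inner_apply, e]
    by_cases ht : t ∈ Set.Icc (-(1 / 2) : ℝ) (1 / 2)
    · rw [Set.indicator_of_mem ht, Complex.conj_conj]
    · rw [(hφ n).eq_zero t ht, zero_mul, zero_mul]
  have e2 : star (inner ℂ w (he.toLp e)) =
      transform (Set.indicator (Set.Icc (-(1 / 2) : ℝ) (1 / 2)) w) z := by
    rw [Complex.star_def, inner_conj_symm, L2.inner_def, transform]
    refine integral_congr_ae ?_
    filter_upwards [he.coeFn_toLp] with t h2
    simp only [h2, RCLike.inner_apply, e]
    by_cases ht : t ∈ Set.Icc (-(1 / 2) : ℝ) (1 / 2)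
    · rw [Set.indicator_of_mem ht, Set.indicator_of_mem ht, Complex.conj_conj]
    · rw [Set.indicator_of_notMem ht, Set.indicator_of_notMem ht, map_zero, mul_zero, zero_mul]
  simp only [e1] at h
  rw [e2] at h
  exact h

theorem continuous_fourier {u : ℝ → ℂ} (hu : Integrable u) : Continuous (𝓕 u) :=
  VectorFourier.fourierIntegral_continuous Real.continuous_fourierChar
    (by exact continuous_inner) hu

theorem IsAdmissible.fourier_eq_zero {R : ℂ → ℂ} (hR : IsAdmissible R) {t : ℝ} (ht : 1 ≤ |t|) :
    𝓕 (fun x : ℝ => R x) t = 0 := by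
  have hc := continuous_fourier hR.integrable
  have hclosed : IsClosed {t | 𝓕 (fun x : ℝ => R x) t = 0} := isClosed_eq hc continuous_const
  have hout : ∀ t : ℝ, t ∉ Set.Icc (-1 : ℝ) 1 → 𝓕 (fun x : ℝ => R x) t = 0 := fun t ht => by
    by_contra h
    exact ht (hR.fourier_support h)
  rcases le_abs.1 ht with h | h
  · have := closure_minimal (s := Set.Ioi (1 : ℝ)) (fun t ht => hout t fun h =>
      absurd h.2 (not_le.2 ht)) hclosed
    rw [closure_Ioi] at this
    exact this h
  · have := closure_minimal (s := Set.Iio (-1 : ℝ)) (fun t ht => hout t fun h =>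
      absurd h.1 (not_le.2 ht)) hclosed
    rw [closure_Iio] at this
    exact this (show t ≤ -1 by linarith)

theorem IsAdmissible.eq_integral {R : ℂ → ℂ} (hR : IsAdmissible R) (x : ℝ) :
    R (-x : ℝ) = ∫ t : ℝ, 𝓕 (fun x : ℝ => R x) t * Complex.exp (-(2 * π * Complex.I * x * t)) := by
  have hc := continuous_fourier hR.integrable
  have hsupp : HasCompactSupport (𝓕 (fun x : ℝ => R x)) := by
    refine HasCompactSupport.intro (isCompact_Icc (a := (-1 : ℝ)) (b := 1)) fun t ht => ?_
    by_contra h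
    exact ht (hR.fourier_support h)
  have hcont : Continuous fun x : ℝ => R x := hR.entire.continuous.comp Complex.continuous_ofReal
  have := hcont.fourierInv_fourier_eq hR.integrable (hc.integrable_of_hasCompactSupport hsupp)
  have h1 := congrFun this (-x)
  rw [← h1, Real.fourierInv_eq_fourier_neg, neg_neg, ← transform_ofReal, transform]

open Polynomial in
/-- The Fejér–Riesz factor of a Riemann sum of the inversion formula. -/
theorem exists_polynomial_approx {u : ℝ → ℂ} (hu : Integrable u) {r : ℝ → ℝ}
    (hr : ∀ y, 0 ≤ r y) (hur : ∀ y, u y = r y) (h0 : ∀ t, 1 ≤ |t| → 𝓕 u t = 0) (n : ℕ) :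
    ∃ p : ℂ[X], p.natDegree ≤ n ∧
      ((n : ℝ) + 1) * ∑ j ∈ Finset.range (n + 1), ‖p.coeff j‖ ^ 2 ≤ ‖𝓕 u 0‖ + 1 ∧
      ∀ z : ℂ, ‖z‖ = 1 → ((‖p.eval z‖ ^ 2 : ℝ) : ℂ) =
        1 / ((n : ℂ) + 1) * ∑ k ∈ Finset.range (2 * n + 1),
          𝓕 u ((((k : ℤ) - n : ℤ) : ℝ) / ((n : ℝ) + 1)) * z ^ ((k : ℤ) - n) +
        1 / ((n : ℂ) + 1) ^ 2 := by
  have hn : (0 : ℝ) < (n : ℝ) + 1 := by positivity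
  have hnC : (n : ℂ) + 1 ≠ 0 := by exact_mod_cast hn.ne'
  let b : ℕ → ℂ := fun k => 1 / ((n : ℂ) + 1) * 𝓕 u ((((k : ℤ) - n : ℤ) : ℝ) / ((n : ℝ) + 1)) +
    if k = n then 1 / ((n : ℂ) + 1) ^ 2 else 0
  let P : ℂ[X] := ∑ k ∈ Finset.range (2 * n + 1), C (b k) * X ^ k
  have hdeg : P.natDegree ≤ 2 * n := by
    refine natDegree_sum_le_of_forall_le _ _ fun k hk => ?_
    rw [Finset.mem_range] at hk
    exact (natDegree_C_mul_X_pow_le _ _).trans (by omega)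
  have hcoeff : P.coeff n = 1 / ((n : ℂ) + 1) * 𝓕 u 0 + 1 / ((n : ℂ) + 1) ^ 2 := by
    simp only [P, finsetSum_coeff, coeff_C_mul, coeff_X_pow, mul_ite, mul_one, mul_zero]
    rw [Finset.sum_ite_eq, if_pos (Finset.mem_range.2 (by omega))]
    simp [b]
  have heval : ∀ z : ℂ, ‖z‖ = 1 → P.eval z = z ^ n *
      (1 / ((n : ℂ) + 1) * ∑ k ∈ Finset.range (2 * n + 1),
          𝓕 u ((((k : ℤ) - n : ℤ) : ℝ) / ((n : ℝ) + 1)) * z ^ ((k : ℤ) - n) +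
        1 / ((n : ℂ) + 1) ^ 2) := by
    intro z hz
    have hz0 : z ≠ 0 := by
      rintro rfl
      simp at hz
    simp only [P, eval_finsetSum, eval_mul, eval_C, eval_pow, eval_X, b, add_mul,
      Finset.sum_add_distrib, ite_mul, zero_mul]
    rw [Finset.sum_ite_eq', if_pos (Finset.mem_range.2 (by omega)), mul_add, Finset.mul_sum,
      Finset.mul_sum]
    congr 1
    · refine Finset.sum_congr rfl fun k _ => ?_
      rw [zpow_sub₀ hz0, zpow_natCast, zpow_natCast]
      field_simp
    · ring
  have hpos : ∀ z : ℂ, ‖z‖ = 1 → ∃ s : ℝ, 0 < s ∧ P.eval z = z ^ n * s := by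
    intro z hz
    obtain ⟨s, hs, hs'⟩ := exists_symmSum_eq_of_toeplitz_nonneg (n := n)
      (G := fun m : ℤ => 𝓕 u ((m : ℝ) / ((n : ℝ) + 1)) * z ^ m) (fun m hm => by
        rw [h0 _ ?_, zero_mul]
        rw [abs_div, abs_of_pos hn, le_div_iff₀ hn, one_mul, ← Int.cast_abs, Int.abs_eq_natAbs]
        exact_mod_cast hm) fun m => toeplitz_fourier_nonneg hu hr hur _ hz m
    rw [symmSum_eq_sum_range] at hs'
    refine ⟨1 / ((n : ℝ) + 1) * s + 1 / ((n : ℝ) + 1) ^ 2, by positivity, ?_⟩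
    rw [heval z hz, hs']
    push_cast
    rfl
  obtain ⟨p, hp, hpe⟩ := exists_eval_eq_normSq n P hdeg hpos
  refine ⟨p, hp, ?_, fun z hz => ?_⟩
  · have h1 := coeff_eq_sum_normSq hp hpe
    rw [hcoeff] at h1
    have h2 : (((((n : ℝ) + 1) * ∑ j ∈ Finset.range (n + 1), ‖p.coeff j‖ ^ 2 : ℝ)) : ℂ) =
        𝓕 u 0 + 1 / ((n : ℂ) + 1) := by
      rw [Complex.ofReal_mul, Complex.ofReal_sum, ← h1]
      push_cast
      field_simp
    have h3 : 0 ≤ ((n : ℝ) + 1) * ∑ j ∈ Finset.range (n + 1), ‖p.coeff j‖ ^ 2 := by positivity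
    rw [← abs_of_nonneg h3, ← Real.norm_eq_abs, ← Complex.norm_real, h2]
    refine (norm_add_le _ _).trans ?_
    gcongr
    rw [norm_div, norm_one, ← Nat.cast_add_one, Complex.norm_natCast]
    rw [div_le_one (by positivity)]
    push_cast
    linarith [(Nat.cast_nonneg n : (0 : ℝ) ≤ n)]
  · have hz0 : z ≠ 0 := by
      rintro rfl
      simp at hz
    have := hpe z hz
    rw [heval z hz] at this
    exact (mul_left_cancel₀ (pow_ne_zero n hz0) this).symm

/-- A nonnegative admissible function is, on the real line, the square of the modulus of the
Fourier transform of a square integrable function supported in `[-1/2, 1/2]`. -/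
theorem IsAdmissible.exists_profile {R : ℂ → ℂ} (hR : IsAdmissible R)
    (hpos : ∀ x : ℝ, (R x).im = 0 ∧ 0 ≤ (R x).re) :
    ∃ φ, IsProfile φ ∧ ∀ x : ℝ, R x = transform φ x * conj (transform φ x) := by
  let u : ℝ → ℂ := fun x => R x
  have hur : ∀ y, u y = ((R y).re : ℝ) := fun y => Complex.ext rfl (by simpa [u] using (hpos y).1)
  choose p hdeg hsum heval using exists_polynomial_approx (u := u) hR.integrable
    (fun y => (hpos y).2) hur fun t ht => hR.fourier_eq_zero ht
  have hprof : ∀ n, IsProfile (stepFun n (p n).coeff) := fun n => isProfile_stepFun _ _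
  obtain ⟨ψ, hψ, hlim⟩ := exists_tendsto_transform hprof
    (fun n => (integral_normSq_stepFun n (p n).coeff).le.trans (hsum n)) (hyperfilter ℕ)
  have key : ∀ x : ℝ, R (-x : ℝ) = transform ψ x * conj (transform ψ x) := by
    intro x
    let z : ℕ → ℂ := fun n => Complex.exp (-(2 * π * Complex.I * x / ((n : ℂ) + 1)))
    have hz : ∀ n, ‖z n‖ = 1 := by
      intro n
      have : -(2 * π * Complex.I * x / ((n : ℂ) + 1)) =
          ((-(2 * π * x / ((n : ℝ) + 1)) : ℝ) : ℂ) * Complex.I := by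
        push_cast
        ring
      simp only [z]
      rw [this, Complex.norm_exp_ofReal_mul_I]
    have hR1 : Tendsto (fun n : ℕ => (((‖(p n).eval (z n)‖ ^ 2 : ℝ)) : ℂ)) atTop
        (𝓝 (R (-x : ℝ))) := by
      have h1 := tendsto_riemann_sum (H := fun t : ℝ =>
        𝓕 u t * Complex.exp (-(2 * π * Complex.I * x * t)))
        ((continuous_fourier hR.integrable).mul (by fun_prop))
        (fun t ht => by rw [hR.fourier_eq_zero ht, zero_mul])
      rw [← hR.eq_integral x] at h1
      have h2 : Tendsto (fun n : ℕ => 1 / ((n : ℂ) + 1) ^ 2) atTop (𝓝 0) := by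
        have := (tendsto_one_div_add_atTop_nhds_zero_nat (𝕜 := ℂ)).pow 2
        simpa using this
      have h3 := h1.add h2
      rw [add_zero] at h3
      refine h3.congr fun n => ?_
      rw [heval n (z n) (hz n)]
      congr 2
      refine Finset.sum_congr rfl fun k _ => ?_
      congr 1
      simp only [z]
      rw [← Complex.exp_int_mul]
      congr 1
      push_cast
      ring
    have hT : ∀ n, transform (stepFun n (p n).coeff) x *
        conj (transform (stepFun n (p n).coeff) x) =
        ((‖((n : ℂ) + 1) * ∫ t in (0 : ℝ)..1 / ((n : ℝ) + 1),
          Complex.exp (-(2 * π * Complex.I * x * t))‖ ^ 2 : ℝ) : ℂ) *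
        ((‖(p n).eval (z n)‖ ^ 2 : ℝ) : ℂ) := by
      intro n
      rw [Complex.mul_conj, Complex.normSq_eq_norm_sq, transform_stepFun,
        Polynomial.eval_eq_sum_range' (Nat.lt_succ_of_le (hdeg n)), norm_mul, norm_mul]
      have : ‖Complex.exp (π * Complex.I * x)‖ = 1 := by
        have : (π * Complex.I * x : ℂ) = ((π * x : ℝ) : ℂ) * Complex.I := by
          push_cast
          ring
        rw [this, Complex.norm_exp_ofReal_mul_I]
      rw [this, mul_one, mul_pow, Complex.ofReal_mul]
    have hA : Tendsto (fun n : ℕ => transform (stepFun n (p n).coeff) x *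
        conj (transform (stepFun n (p n).coeff) x)) atTop (𝓝 (R (-x : ℝ))) := by
      have h1 := (Complex.continuous_ofReal.tendsto _).comp ((tendsto_average_exp x).norm.pow 2)
      have h2 := h1.mul hR1
      simp only [norm_one, one_pow, Complex.ofReal_one, one_mul] at h2
      exact h2.congr fun n => (hT n).symm
    have hB := (hlim x).mul ((Complex.continuous_conj.tendsto _).comp (hlim x))
    exact tendsto_nhds_unique (hA.mono_left Nat.hyperfilter_le_atTop) hB
  refine ⟨fun t => ψ (-t), hψ.reflect, fun x => ?_⟩
  have := key (-x)
  rw [neg_neg] at this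
  rw [this, transform_reflect]
  push_cast
  rfl

/-- The indicator function of `[-1/2, 1/2]`. -/
noncomputable def unitBox : ℝ → ℂ := Set.indicator (Set.Icc (-(1 / 2) : ℝ) (1 / 2)) 1

theorem isProfile_indicator {ψ : ℝ → ℂ} (hψ : Continuous ψ) :
    IsProfile (Set.indicator (Set.Icc (-(1 / 2) : ℝ) (1 / 2)) ψ) := by
  refine ⟨?_, fun t ht => Set.indicator_of_notMem ht _⟩
  rw [memLp_indicator_iff_restrict measurableSet_Icc]
  obtain ⟨C, hC⟩ := isCompact_Icc.exists_bound_of_continuousOn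
    (hψ.continuousOn (s := Set.Icc (-(1 / 2) : ℝ) (1 / 2)))
  exact MemLp.of_bound hψ.aestronglyMeasurable C
    ((ae_restrict_iff' measurableSet_Icc).2 (Eventually.of_forall hC))

theorem isProfile_unitBox : IsProfile unitBox := isProfile_indicator continuous_one

theorem transform_indicator (ψ : ℝ → ℂ) (z : ℂ) :
    transform (Set.indicator (Set.Icc (-(1 / 2) : ℝ) (1 / 2)) ψ) z =
      ∫ t in (-(1 / 2) : ℝ)..(1 / 2), ψ t * Complex.exp (-(2 * π * Complex.I * z * t)) := by
  rw [intervalIntegral.integral_of_le (by norm_num), ← integral_Icc_eq_integral_Ioc,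
    ← integral_indicator measurableSet_Icc, transform]
  congr 1
  ext t
  by_cases ht : t ∈ Set.Icc (-(1 / 2) : ℝ) (1 / 2)
  · rw [Set.indicator_of_mem ht, Set.indicator_of_mem ht]
  · rw [Set.indicator_of_notMem ht, Set.indicator_of_notMem ht, zero_mul]

theorem integral_exp_eq_sincPi (z : ℂ) :
    ∫ t in (-(1 / 2) : ℝ)..(1 / 2), Complex.exp (-(2 * π * Complex.I * z * t)) = sincPi z := by
  by_cases hz : z = 0
  · simp [hz, sincPi]
    norm_num
  · have hc : -(2 * π * Complex.I * z) ≠ 0 := by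
      simp [hz, Real.pi_ne_zero]
    have := integral_exp_mul_complex (a := -(1 / 2)) (b := 1 / 2) hc
    simp only [← neg_mul] at this ⊢
    rw [this, sincPi, if_neg hz, Complex.sin]
    have e1 : -2 * π * Complex.I * z * ((1 / 2 : ℝ) : ℂ) = -(π * z) * Complex.I := by
      push_cast
      ring
    have e2 : -2 * π * Complex.I * z * ((-(1 / 2) : ℝ) : ℂ) = (π * z) * Complex.I := by
      push_cast
      ring
    rw [e1, e2]
    have hπ : (π : ℂ) ≠ 0 := by exact_mod_cast Real.pi_ne_zero
    field_simp
    ring_nf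
    simp only [Complex.I_sq]
    ring

theorem transform_unitBox (z : ℂ) : transform unitBox z = sincPi z := by
  rw [unitBox, transform_indicator, ← integral_exp_eq_sincPi]
  simp

theorem sincPi_ofReal (x : ℝ) : sincPi x = (Real.sinc (π * x) : ℝ) := by
  by_cases hx : x = 0
  · simp [hx, sincPi]
  · rw [Real.sinc_of_ne_zero (by positivity), sincPi, if_neg (by exact_mod_cast hx)]
    push_cast
    rfl

theorem density_eq (x : ℝ) :
    (density x : ℂ) = 1 - transform unitBox x * conj (transform unitBox x) := by
  rw [transform_unitBox, sincPi_ofReal, Complex.conj_ofReal, density]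
  push_cast
  ring

theorem integral_unitBox_sub_mul {u : ℝ} (hu : |u| ≤ 1) :
    ∫ t, unitBox (t - u) * conj (unitBox t) = ((1 - |u| : ℝ) : ℂ) := by
  have h : ∀ t, unitBox (t - u) * conj (unitBox t) =
      Set.indicator (Set.Icc (max (-(1 / 2)) (u - 1 / 2)) (min (1 / 2) (u + 1 / 2)))
        (fun _ => (1 : ℂ)) t := by
    intro t
    have hiff : t ∈ Set.Icc (max (-(1 / 2)) (u - 1 / 2)) (min (1 / 2) (u + 1 / 2)) ↔
        t - u ∈ Set.Icc (-(1 / 2) : ℝ) (1 / 2) ∧ t ∈ Set.Icc (-(1 / 2) : ℝ) (1 / 2) := by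
      simp only [Set.mem_Icc, max_le_iff, le_min_iff]
      constructor
      · rintro ⟨⟨h1, h2⟩, h3, h4⟩
        exact ⟨⟨by linarith, by linarith⟩, h1, h3⟩
      · rintro ⟨⟨h1, h2⟩, h3, h4⟩
        exact ⟨⟨h3, by linarith⟩, h4, by linarith⟩
    simp only [unitBox, Set.indicator_apply, hiff, Pi.one_apply]
    by_cases h1 : t - u ∈ Set.Icc (-(1 / 2) : ℝ) (1 / 2) <;>
      by_cases h2 : t ∈ Set.Icc (-(1 / 2) : ℝ) (1 / 2) <;>
      simp only [h1, h2, and_self, and_true, if_true, if_false, map_one, map_zero,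
        mul_zero, mul_one, and_false]
  simp only [h]
  rw [integral_indicator_const _ measurableSet_Icc, Real.volume_real_Icc]
  rw [Complex.real_smul, mul_one]
  congr 1
  rcases abs_cases u with ⟨h1, h2⟩ | ⟨h1, h2⟩
  · simp only [max_def, min_def]
    split_ifs <;> linarith
  · simp only [max_def, min_def]
    split_ifs <;> linarith

theorem fourier_sq_sinc {u : ℝ} (hu : |u| ≤ 1) :
    𝓕 (fun x : ℝ => transform unitBox x * conj (transform unitBox x)) u =
      ((1 - |u| : ℝ) : ℂ) := by
  rw [Real.fourier_real_eq_integral_exp_smul, ← integral_unitBox_sub_mul hu,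
    ← integral_exp_mul_transform_mul_conj isProfile_unitBox isProfile_unitBox]
  simp only [smul_eq_mul]

theorem integral_fourier_mul_eq {u v : ℝ → ℂ} (hu : Integrable u) (hv : Integrable v) :
    ∫ x, 𝓕 u x * v x = ∫ x, u x * 𝓕 v x := by
  have := VectorFourier.integral_fourierIntegral_smul_eq_flip (L := innerₗ ℝ)
    (μ := (volume : Measure ℝ)) (ν := (volume : Measure ℝ)) Real.continuous_fourierChar
    (by exact continuous_inner) hu hv
  rw [flip_innerₗ] at this
  exact this

theorem IsProfile.norm_transform_le {φ : ℝ → ℂ} (x : ℝ) :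
    ‖transform φ x‖ ≤ ∫ t, ‖φ t‖ := by
  rw [transform_ofReal]
  exact VectorFourier.norm_fourierIntegral_le_integral_norm _ _ _ _ _

/-- The integral operator with kernel `1 - |t - s|`. -/
noncomputable def triangleOp (ψ : ℝ → ℂ) (t : ℝ) : ℂ := ∫ s, ψ s * ((1 - |t - s| : ℝ) : ℂ)

theorem integral_exp_transform_mul_sq_sinc {ψ : ℝ → ℂ} (hψ : IsProfile ψ) {t : ℝ}
    (ht : t ∈ Set.Icc (-(1 / 2) : ℝ) (1 / 2)) :
    ∫ x : ℝ, transform ψ x * (Complex.exp ((2 * π * x * t : ℝ) * Complex.I) *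
      (transform unitBox x * conj (transform unitBox x))) = triangleOp ψ t := by
  have hS := integrable_transform_mul_conj isProfile_unitBox isProfile_unitBox
  have hS' : Integrable fun x : ℝ => Complex.exp ((2 * π * x * t : ℝ) * Complex.I) *
      (transform unitBox x * conj (transform unitBox x)) := by
    refine Integrable.bdd_mul (c := 1) hS (by fun_prop) (Eventually.of_forall fun y => ?_)
    rw [Complex.norm_exp_ofReal_mul_I]
  simp only [transform_ofReal ψ]
  rw [integral_fourier_mul_eq hψ.integrable hS', triangleOp]
  congr 1
  ext s
  by_cases hs : s ∈ Set.Icc (-(1 / 2) : ℝ) (1 / 2)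
  · rw [abs_sub_comm, ← fourier_sq_sinc (abs_le.2
      ⟨by linarith [hs.1, ht.2], by linarith [hs.2, ht.1]⟩)]
    congr 1
    rw [Real.fourier_real_eq_integral_exp_smul, Real.fourier_real_eq_integral_exp_smul]
    congr 1
    ext x
    rw [smul_eq_mul, smul_eq_mul, ← mul_assoc, ← Complex.exp_add]
    congr 2
    push_cast
    ring
  · rw [hψ.eq_zero s hs, zero_mul, zero_mul]

/-- The Hermitian form `∫ F(x) conj (G x) (1 - (sin π x / (π x)) ^ 2) dx` of two transforms. -/
noncomputable def form (φ ψ : ℝ → ℂ) : ℂ :=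
  ∫ x : ℝ, transform φ x * conj (transform ψ x) * density x

theorem integrable_mul_sq_sinc {φ ψ : ℝ → ℂ} (hφ : IsProfile φ) (hψ : IsProfile ψ) :
    Integrable fun x : ℝ => transform φ x * (conj (transform ψ x) *
      (transform unitBox x * conj (transform unitBox x))) := by
  have hS := integrable_transform_mul_conj isProfile_unitBox isProfile_unitBox
  refine Integrable.bdd_mul (c := ∫ t, ‖φ t‖) ?_ hφ.continuous_transform.aestronglyMeasurable
    (Eventually.of_forall fun x => IsProfile.norm_transform_le x)
  refine Integrable.bdd_mul (c := ∫ t, ‖ψ t‖) hS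
    (Complex.continuous_conj.comp hψ.continuous_transform).aestronglyMeasurable
    (Eventually.of_forall fun x => ?_)
  rw [RCLike.norm_conj]
  exact IsProfile.norm_transform_le x

theorem form_integrand_eq (φ ψ : ℝ → ℂ) (x : ℝ) :
    transform φ x * conj (transform ψ x) * density x =
      transform φ x * conj (transform ψ x) - transform φ x * (conj (transform ψ x) *
      (transform unitBox x * conj (transform unitBox x))) := by
  rw [density_eq]
  ring

theorem integrable_form {φ ψ : ℝ → ℂ} (hφ : IsProfile φ) (hψ : IsProfile ψ) :
    Integrable fun x : ℝ => transform φ x * conj (transform ψ x) * density x := by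
  simp only [form_integrand_eq]
  exact (integrable_transform_mul_conj hφ hψ).sub (integrable_mul_sq_sinc hφ hψ)

theorem form_eq {φ ψ : ℝ → ℂ} (hφ : IsProfile φ) (hψ : IsProfile ψ) :
    form φ ψ = (∫ t, φ t * conj (ψ t)) - ∫ t, φ t * conj (triangleOp ψ t) := by
  have hS := integrable_transform_mul_conj isProfile_unitBox isProfile_unitBox
  have hG : Integrable fun x : ℝ => conj (transform ψ x) *
      (transform unitBox x * conj (transform unitBox x)) := by
    refine Integrable.bdd_mul (c := ∫ t, ‖ψ t‖) hS
      (Complex.continuous_conj.comp hψ.continuous_transform).aestronglyMeasurable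
      (Eventually.of_forall fun x => ?_)
    rw [RCLike.norm_conj]
    exact IsProfile.norm_transform_le x
  unfold form
  simp only [form_integrand_eq]
  rw [integral_sub (integrable_transform_mul_conj hφ hψ) (integrable_mul_sq_sinc hφ hψ),
    integral_transform_mul_conj hφ hψ]
  congr 1
  simp only [transform_ofReal φ]
  rw [integral_fourier_mul_eq hφ.integrable hG]
  congr 1
  ext t
  by_cases ht : t ∈ Set.Icc (-(1 / 2) : ℝ) (1 / 2)
  · congr 1
    rw [← integral_exp_transform_mul_sq_sinc hψ ht, ← integral_conj,
      Real.fourier_real_eq_integral_exp_smul]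
    congr 1
    ext x
    rw [smul_eq_mul, map_mul, map_mul, ← Complex.exp_conj, map_mul, map_mul, Complex.conj_conj,
      Complex.conj_ofReal, Complex.conj_I, mul_comm (conj (transform unitBox x))]
    have : ((-2 * π * x * t : ℝ) : ℂ) * Complex.I = ((2 * π * x * t : ℝ) : ℂ) * -Complex.I := by
      push_cast
      ring
    rw [this]
    ring
  · rw [hφ.eq_zero t ht, zero_mul, zero_mul]

/-- A solution of the integral equation `ψ - T ψ = exp (2 π i x ·)` represents the evaluation
at `x`. -/
theorem form_eq_transform {φ ψ : ℝ → ℂ} (hφ : IsProfile φ) (hψ : IsProfile ψ) {x : ℝ}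
    (h : ∀ t ∈ Set.Icc (-(1 / 2) : ℝ) (1 / 2),
      ψ t - triangleOp ψ t = Complex.exp (2 * π * Complex.I * x * t)) :
    form φ ψ = transform φ x := by
  have hint : Integrable fun t => φ t * conj (ψ t) := hφ.memLp.integrable_mul hψ.memLp.star
  have heq : ∀ t, φ t * conj (triangleOp ψ t) =
      φ t * conj (ψ t) - φ t * Complex.exp (-(2 * π * Complex.I * x * t)) := by
    intro t
    by_cases ht : t ∈ Set.Icc (-(1 / 2) : ℝ) (1 / 2)
    · have h1 : triangleOp ψ t = ψ t - Complex.exp (2 * π * Complex.I * x * t) := by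
        rw [← h t ht]
        ring
      rw [h1, map_sub, ← Complex.exp_conj, mul_sub]
      simp [Complex.conj_ofNat]
    · simp [hφ.eq_zero t ht]
  rw [form_eq hφ hψ]
  simp only [heq]
  rw [integral_sub hint (hφ.integrable_mul_exp x), transform]
  ring

theorem triangle_mul_exp_integral (l : ℂ) {t : ℝ} (ht : t ∈ Set.Icc (-(1 / 2) : ℝ) (1 / 2)) :
    l ^ 2 * ∫ s in (-(1 / 2) : ℝ)..(1 / 2), Complex.exp (l * s) * ((1 - |t - s| : ℝ) : ℂ) =
      -2 * Complex.exp (l * t) +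
        l * ((1 / 2 + t) * Complex.exp (l / 2) - (1 / 2 - t) * Complex.exp (-(l / 2))) +
        Complex.exp (l / 2) + Complex.exp (-(l / 2)) := by
  have hc : Continuous fun s : ℝ => Complex.exp (l * s) * ((1 - |t - s| : ℝ) : ℂ) :=
    Continuous.mul (by fun_prop) (Complex.continuous_ofReal.comp (by fun_prop))
  rw [← intervalIntegral.integral_add_adjacent_intervals (hc.intervalIntegrable _ t)
    (hc.intervalIntegrable t _), mul_add, ← intervalIntegral.integral_const_mul,
    ← intervalIntegral.integral_const_mul]
  have hexp : ∀ s : ℝ, HasDerivAt (fun s : ℝ => Complex.exp (l * s)) (l * Complex.exp (l * s)) s := by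
    intro s
    have := ((hasDerivAt_id (s : ℂ)).const_mul l).cexp.comp_ofReal
    simpa [mul_comm] using this
  have hid : ∀ s : ℝ, HasDerivAt (fun s : ℝ => (s : ℂ)) 1 s := fun s =>
    (hasDerivAt_id (s : ℂ)).comp_ofReal
  have h1 : ∫ s in (-(1 / 2) : ℝ)..t, l ^ 2 * (Complex.exp (l * s) * ((1 - |t - s| : ℝ) : ℂ)) =
      (l * (1 - t + t) * Complex.exp (l * t) - Complex.exp (l * t)) -
        (l * (1 - t + ((-(1 / 2) : ℝ) : ℂ)) * Complex.exp (l * ((-(1 / 2) : ℝ) : ℂ)) -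
          Complex.exp (l * ((-(1 / 2) : ℝ) : ℂ))) := by
    rw [← intervalIntegral.integral_eq_sub_of_hasDerivAt (a := -(1 / 2)) (b := t)
      (f := fun s : ℝ => l * (1 - t + s) * Complex.exp (l * s) - Complex.exp (l * s))
      (f' := fun s : ℝ => l ^ 2 * (Complex.exp (l * s) * (1 - t + s)))]
    · refine intervalIntegral.integral_congr fun s hs => ?_
      rw [Set.uIcc_of_le ht.1] at hs
      rw [abs_of_nonneg (by linarith [hs.2])]
      push_cast
      ring
    · intro s _
      have := ((((hid s).const_add (1 - (t : ℂ))).const_mul l).mul (hexp s)).sub (hexp s)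
      refine this.congr_deriv ?_
      ring
    · exact Continuous.intervalIntegrable (by fun_prop) _ _
  have h2 : ∫ s in t..(1 / 2), l ^ 2 * (Complex.exp (l * s) * ((1 - |t - s| : ℝ) : ℂ)) =
      (l * (1 + t - ((1 / 2 : ℝ) : ℂ)) * Complex.exp (l * ((1 / 2 : ℝ) : ℂ)) +
          Complex.exp (l * ((1 / 2 : ℝ) : ℂ))) -
        (l * (1 + t - t) * Complex.exp (l * t) + Complex.exp (l * t)) := by
    rw [← intervalIntegral.integral_eq_sub_of_hasDerivAt (a := t) (b := 1 / 2)
      (f := fun s : ℝ => l * (1 + t - s) * Complex.exp (l * s) + Complex.exp (l * s))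
      (f' := fun s : ℝ => l ^ 2 * (Complex.exp (l * s) * (1 + t - s)))]
    · refine intervalIntegral.integral_congr fun s hs => ?_
      rw [Set.uIcc_of_le ht.2] at hs
      rw [abs_of_nonpos (by linarith [hs.1])]
      push_cast
      ring
    · intro s _
      have := ((((hid s).const_sub (1 + (t : ℂ))).const_mul l).mul (hexp s)).add (hexp s)
      refine this.congr_deriv ?_
      ring
    · exact Continuous.intervalIntegrable (by fun_prop) _ _
  rw [h1, h2]
  have e1 : l * ((-(1 / 2) : ℝ) : ℂ) = -(l / 2) := by
    push_cast
    ring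
  have e2 : l * ((1 / 2 : ℝ) : ℂ) = l / 2 := by
    push_cast
    ring
  rw [e1, e2]
  push_cast
  ring

theorem a_sq : a ^ 2 = 1 / 2 := by
  have h : (1 / √2 : ℝ) ^ 2 = 1 / 2 := by
    rw [div_pow, Real.sq_sqrt (by norm_num), one_pow]
  rw [a, ← Complex.ofReal_pow, h]
  push_cast
  rfl

theorem sqrt_two_eq : ((√2 : ℝ) : ℂ) = 2 * a := by
  rw [a]
  have h : √2 = 2 * (1 / √2) := by
    have h1 : √2 ≠ 0 := by positivity
    have h2 : √2 * √2 = 2 := Real.mul_self_sqrt (by norm_num)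
    field_simp
    linarith
  exact_mod_cast congrArg ((↑) : ℝ → ℂ) h

theorem a_ne_zero : a ≠ 0 := by
  intro h
  have := a_sq
  rw [h] at this
  norm_num at this

theorem real_a_bounds : 3 / 4 ≤ Real.cos (1 / √2) ∧
    1 / 4 ≤ Real.cos (1 / √2) - 1 / √2 * Real.sin (1 / √2) := by
  have h : (1 / √2 : ℝ) ^ 2 = 1 / 2 := by
    rw [div_pow, Real.sq_sqrt (by norm_num), one_pow]
  have h0 : (0 : ℝ) ≤ 1 / √2 := by positivity
  have h1 := Real.one_sub_sq_div_two_le_cos (x := 1 / √2)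
  have h2 := Real.sin_le h0
  constructor
  · linarith
  · nlinarith

theorem cos_a_ne_zero : Complex.cos a ≠ 0 := by
  rw [a, ← Complex.ofReal_cos]
  have := real_a_bounds.1
  exact_mod_cast (by linarith : 0 < Real.cos (1 / √2)).ne'

theorem cos_sub_ne_zero : Complex.cos a - a * Complex.sin a ≠ 0 := by
  rw [a, ← Complex.ofReal_cos, ← Complex.ofReal_sin]
  have := real_a_bounds.2
  exact_mod_cast (by linarith : 0 < Real.cos (1 / √2) - 1 / √2 * Real.sin (1 / √2)).ne'

/-- The explicit solution of the integral equation with right hand side `exp (2 π i v t)`. -/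
noncomputable def explicitSolution (v : ℂ) (t : ℝ) : ℂ :=
  2 * (π : ℂ) ^ 2 * v ^ 2 / (2 * (π : ℂ) ^ 2 * v ^ 2 - 1) *
      Complex.exp (2 * π * Complex.I * v * t) +
    (c v + d v) / 2 * Complex.exp (2 * Complex.I * a * t) +
    (c v - d v) / 2 * Complex.exp (-(2 * Complex.I * a) * t)

theorem continuous_explicitSolution (v : ℂ) : Continuous (explicitSolution v) := by
  unfold explicitSolution
  fun_prop

theorem triangleOp_indicator (ψ : ℝ → ℂ) (t : ℝ) :
    triangleOp (Set.indicator (Set.Icc (-(1 / 2) : ℝ) (1 / 2)) ψ) t =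
      ∫ s in (-(1 / 2) : ℝ)..(1 / 2), ψ s * ((1 - |t - s| : ℝ) : ℂ) := by
  rw [intervalIntegral.integral_of_le (by norm_num), ← integral_Icc_eq_integral_Ioc,
    ← integral_indicator measurableSet_Icc, triangleOp]
  congr 1
  ext s
  by_cases hs : s ∈ Set.Icc (-(1 / 2) : ℝ) (1 / 2)
  · rw [Set.indicator_of_mem hs, Set.indicator_of_mem hs]
  · rw [Set.indicator_of_notMem hs, Set.indicator_of_notMem hs, zero_mul]

theorem q_eq (v : ℂ) : 2 * (π : ℂ) ^ 2 * v ^ 2 - 1 = -q v := by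
  rw [q]
  ring

theorem explicitSolution_sub {v : ℂ} (hv : q v ≠ 0) {t : ℝ}
    (ht : t ∈ Set.Icc (-(1 / 2) : ℝ) (1 / 2)) :
    explicitSolution v t -
        ∫ s in (-(1 / 2) : ℝ)..(1 / 2), explicitSolution v s * ((1 - |t - s| : ℝ) : ℂ) =
      Complex.exp (2 * π * Complex.I * v * t) := by
  have hI : ∀ (k l : ℂ), IntervalIntegrable (fun s : ℝ =>
      k * (Complex.exp (l * s) * ((1 - |t - s| : ℝ) : ℂ))) volume (-(1 / 2)) (1 / 2) := by
    intro k l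
    refine Continuous.intervalIntegrable ?_ _ _
    exact continuous_const.mul (Continuous.mul (by fun_prop)
      (Complex.continuous_ofReal.comp (by fun_prop)))
  have h0 := triangle_mul_exp_integral (2 * π * Complex.I * v) ht
  have h1 := triangle_mul_exp_integral (2 * Complex.I * a) ht
  have h2 := triangle_mul_exp_integral (-(2 * Complex.I * a)) ht
  have hsplit : ∫ s in (-(1 / 2) : ℝ)..(1 / 2), explicitSolution v s * ((1 - |t - s| : ℝ) : ℂ) =
      2 * (π : ℂ) ^ 2 * v ^ 2 / (2 * (π : ℂ) ^ 2 * v ^ 2 - 1) *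
        (∫ s in (-(1 / 2) : ℝ)..(1 / 2),
          Complex.exp (2 * π * Complex.I * v * s) * ((1 - |t - s| : ℝ) : ℂ)) +
      (c v + d v) / 2 * (∫ s in (-(1 / 2) : ℝ)..(1 / 2),
          Complex.exp (2 * Complex.I * a * s) * ((1 - |t - s| : ℝ) : ℂ)) +
      (c v - d v) / 2 * (∫ s in (-(1 / 2) : ℝ)..(1 / 2),
          Complex.exp (-(2 * Complex.I * a) * s) * ((1 - |t - s| : ℝ) : ℂ)) := by
    rw [← intervalIntegral.integral_const_mul, ← intervalIntegral.integral_const_mul,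
      ← intervalIntegral.integral_const_mul, ← intervalIntegral.integral_add (hI _ _) (hI _ _),
      ← intervalIntegral.integral_add ((hI _ _).add (hI _ _)) (hI _ _)]
    refine intervalIntegral.integral_congr fun s _ => ?_
    simp only [explicitSolution]
    ring
  rw [hsplit]
  generalize (∫ s in (-(1 / 2) : ℝ)..(1 / 2),
    Complex.exp (2 * π * Complex.I * v * s) * ((1 - |t - s| : ℝ) : ℂ)) = T₀ at h0 ⊢
  generalize (∫ s in (-(1 / 2) : ℝ)..(1 / 2),
    Complex.exp (2 * Complex.I * a * s) * ((1 - |t - s| : ℝ) : ℂ)) = T₁ at h1 ⊢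
  generalize (∫ s in (-(1 / 2) : ℝ)..(1 / 2),
    Complex.exp (-(2 * Complex.I * a) * s) * ((1 - |t - s| : ℝ) : ℂ)) = T₂ at h2 ⊢
  have e0 : 2 * π * Complex.I * v / 2 = π * v * Complex.I := by ring
  have e1 : 2 * Complex.I * a / 2 = a * Complex.I := by ring
  have e2 : -(2 * Complex.I * a) / 2 = -(a * Complex.I) := by ring
  have f1 : ∀ w : ℂ, Complex.exp (w * Complex.I) = Complex.cos w + Complex.sin w * Complex.I :=
    Complex.exp_mul_I
  have f2 : ∀ w : ℂ, Complex.exp (-(w * Complex.I)) =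
      Complex.cos w - Complex.sin w * Complex.I := by
    intro w
    rw [← neg_mul, Complex.exp_mul_I, Complex.cos_neg, Complex.sin_neg]
    ring
  rw [e0, f1, f2] at h0
  rw [e1, f1, f2] at h1
  rw [e2, f2, neg_neg, f1] at h2
  have hI2 := Complex.I_sq
  have hca : c v * (Complex.cos a - a * Complex.sin a) =
      (Complex.cos (π * v) - π * v * Complex.sin (π * v)) / q v := by
    rw [c]
    have := cos_sub_ne_zero
    field_simp
  have hda : d v * (a * Complex.cos a) = π * v * Complex.cos (π * v) / q v := by
    rw [d, sqrt_two_eq]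
    have := cos_a_ne_zero
    have := a_ne_zero
    field_simp
  have g1 : T₁ = Complex.exp (2 * Complex.I * a * t) - (Complex.cos a - a * Complex.sin a +
      2 * Complex.I * a * t * Complex.cos a) := by
    have h : (2 * Complex.I * a) ^ 2 = -2 := by
      rw [mul_pow, mul_pow, hI2, a_sq]
      norm_num
    rw [h] at h1
    linear_combination (-1 / 2) * h1 - a * Complex.sin a * hI2
  have g2 : T₂ = Complex.exp (-(2 * Complex.I * a) * t) - (Complex.cos a - a * Complex.sin a -
      2 * Complex.I * a * t * Complex.cos a) := by
    have h : (-(2 * Complex.I * a)) ^ 2 = -2 := by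
      rw [neg_sq, mul_pow, mul_pow, hI2, a_sq]
      norm_num
    rw [h] at h2
    linear_combination (-1 / 2) * h2 - a * Complex.sin a * hI2
  have g0 : 2 * (π : ℂ) ^ 2 * v ^ 2 / (2 * (π : ℂ) ^ 2 * v ^ 2 - 1) * T₀ =
      (-Complex.exp (2 * π * Complex.I * v * t) + (Complex.cos (π * v) -
        π * v * Complex.sin (π * v) + 2 * Complex.I * π * v * t * Complex.cos (π * v))) / q v := by
    rw [q_eq]
    generalize Complex.exp (2 * π * Complex.I * v * t) = E at h0 ⊢
    field_simp
    linear_combination (1 / 2) * h0 + (π * v * Complex.sin (π * v) - 2 * π ^ 2 * v ^ 2 * T₀) * hI2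
  rw [g0, g1, g2, explicitSolution, q_eq]
  have hq1 : 2 * (π : ℂ) ^ 2 * v ^ 2 / -q v = 1 - 1 / q v := by
    field_simp
    rw [q]
    ring
  rw [hq1]
  linear_combination hca + 2 * Complex.I * t * hda

theorem neg_half_le_half : (-(1 / 2) : ℝ) ≤ 1 / 2 := by norm_num

/-- The integral operator with kernel `1 - |t - s|` on continuous functions on `[-1/2, 1/2]`. -/
noncomputable def triangleMap :
    C(Set.Icc (-(1 / 2) : ℝ) (1 / 2), ℂ) →ₗ[ℂ] C(Set.Icc (-(1 / 2) : ℝ) (1 / 2), ℂ) where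
  toFun ψ := ⟨fun t => ∫ s in (-(1 / 2) : ℝ)..(1 / 2),
      Set.IccExtend neg_half_le_half ψ s * ((1 - |(t : ℝ) - s| : ℝ) : ℂ), by
    refine intervalIntegral.continuous_parametric_intervalIntegral_of_continuous' ?_ _ _
    exact ((ψ.continuous.Icc_extend' (h := neg_half_le_half)).comp continuous_snd).mul
      (Complex.continuous_ofReal.comp (by fun_prop))⟩
  map_add' ψ₁ ψ₂ := by
    ext t
    simp only [ContinuousMap.coe_mk, ContinuousMap.add_apply]
    rw [← intervalIntegral.integral_add]
    · refine intervalIntegral.integral_congr fun s _ => ?_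
      simp only [Set.IccExtend, Function.comp_apply, ContinuousMap.add_apply]
      ring
    · exact Continuous.intervalIntegrable ((ψ₁.continuous.Icc_extend'
        (h := neg_half_le_half)).mul (Complex.continuous_ofReal.comp (by fun_prop))) _ _
    · exact Continuous.intervalIntegrable ((ψ₂.continuous.Icc_extend'
        (h := neg_half_le_half)).mul (Complex.continuous_ofReal.comp (by fun_prop))) _ _
  map_smul' k ψ := by
    ext t
    simp only [ContinuousMap.coe_mk, ContinuousMap.smul_apply, RingHom.id_apply, smul_eq_mul]
    rw [← intervalIntegral.integral_const_mul]
    refine intervalIntegral.integral_congr fun s _ => ?_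
    simp only [Set.IccExtend, Function.comp_apply, ContinuousMap.smul_apply, smul_eq_mul]
    ring

theorem norm_triangleMap_le (ψ : C(Set.Icc (-(1 / 2) : ℝ) (1 / 2), ℂ)) :
    ‖triangleMap ψ‖ ≤ 11 / 12 * ‖ψ‖ := by
  rw [ContinuousMap.norm_le _ (by positivity)]
  intro t
  have hint : ∫ s in (-(1 / 2) : ℝ)..(1 / 2), ‖ψ‖ * (1 - ((t : ℝ) - s) ^ 2) =
      ‖ψ‖ * (11 / 12 - (t : ℝ) ^ 2) := by
    rw [intervalIntegral.integral_const_mul]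
    have h1 : ∀ s : ℝ, HasDerivAt (fun s : ℝ => s + ((t : ℝ) - s) ^ 3 / 3)
        (1 - ((t : ℝ) - s) ^ 2) s := by
      intro s
      have := (hasDerivAt_id s).add ((((hasDerivAt_id s).const_sub (t : ℝ)).pow 3).div_const 3)
      refine this.congr_deriv ?_
      simp
      ring
    rw [intervalIntegral.integral_eq_sub_of_hasDerivAt (fun s _ => h1 s)
      (Continuous.intervalIntegrable (by fun_prop) _ _)]
    ring
  have hle : ‖triangleMap ψ t‖ ≤ ∫ s in (-(1 / 2) : ℝ)..(1 / 2),
      ‖ψ‖ * (1 - ((t : ℝ) - s) ^ 2) := by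
    refine intervalIntegral.norm_integral_le_of_norm_le neg_half_le_half
      (Eventually.of_forall fun s hs => ?_) (Continuous.intervalIntegrable (by fun_prop) _ _)
    rw [norm_mul, Complex.norm_real, Real.norm_eq_abs]
    have h1 : |(t : ℝ) - s| ≤ 1 :=
      abs_le.2 ⟨by linarith [t.2.1, hs.2], by linarith [t.2.2, hs.1]⟩
    have h2 : ((t : ℝ) - s) ^ 2 ≤ |(t : ℝ) - s| := by
      rw [← sq_abs]
      nlinarith [abs_nonneg ((t : ℝ) - s)]
    rw [abs_of_nonneg (by linarith)]
    gcongr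
    exact ψ.norm_coe_le_norm _
  rw [hint] at hle
  refine hle.trans ?_
  nlinarith [norm_nonneg ψ, mul_nonneg (norm_nonneg ψ) (sq_nonneg (t : ℝ))]

noncomputable def triangleCLM :
    C(Set.Icc (-(1 / 2) : ℝ) (1 / 2), ℂ) →L[ℂ] C(Set.Icc (-(1 / 2) : ℝ) (1 / 2), ℂ) :=
  triangleMap.mkContinuous (11 / 12) norm_triangleMap_le

theorem norm_triangleCLM_lt : ‖triangleCLM‖ < 1 :=
  (LinearMap.mkContinuous_norm_le _ (by norm_num) _).trans_lt (by norm_num)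

/-- The map `v ↦ (t ↦ exp (2 π i v t))`. -/
noncomputable def expMap : C(ℂ, C(Set.Icc (-(1 / 2) : ℝ) (1 / 2), ℂ)) :=
  ContinuousMap.curry ⟨fun p => Complex.exp (2 * π * Complex.I * p.1 * (p.2 : ℝ)), by fun_prop⟩

/-- The solution of `ψ - T ψ = exp (2 π i v ·)`. -/
noncomputable def solution (v : ℂ) : C(Set.Icc (-(1 / 2) : ℝ) (1 / 2), ℂ) :=
  (↑(Units.oneSub triangleCLM norm_triangleCLM_lt)⁻¹ :
    C(Set.Icc (-(1 / 2) : ℝ) (1 / 2), ℂ) →L[ℂ] C(Set.Icc (-(1 / 2) : ℝ) (1 / 2), ℂ)) (expMap v)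

theorem continuous_solution : Continuous solution :=
  (ContinuousLinearMap.continuous _).comp expMap.continuous

theorem solution_sub (v : ℂ) : solution v - triangleCLM (solution v) = expMap v := by
  have h := (Units.oneSub triangleCLM norm_triangleCLM_lt).mul_inv
  have := congrArg (fun L : C(Set.Icc (-(1 / 2) : ℝ) (1 / 2), ℂ) →L[ℂ]
    C(Set.Icc (-(1 / 2) : ℝ) (1 / 2), ℂ) => L (expMap v)) h
  exact this

theorem eq_solution {v : ℂ} {ψ : C(Set.Icc (-(1 / 2) : ℝ) (1 / 2), ℂ)}
    (h : ψ - triangleCLM ψ = expMap v) : ψ = solution v := by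
  have h1 := (Units.oneSub triangleCLM norm_triangleCLM_lt).inv_mul
  have := congrArg (fun L : C(Set.Icc (-(1 / 2) : ℝ) (1 / 2), ℂ) →L[ℂ]
    C(Set.Icc (-(1 / 2) : ℝ) (1 / 2), ℂ) => L ψ) h1
  rw [solution, ← h]
  exact this.symm

/-- The profile of the reproducing kernel at `conj v`. -/
noncomputable def kernelProfile (v : ℂ) : ℝ → ℂ :=
  Set.indicator (Set.Icc (-(1 / 2) : ℝ) (1 / 2)) (Set.IccExtend neg_half_le_half (solution v))

theorem isProfile_kernelProfile (v : ℂ) : IsProfile (kernelProfile v) :=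
  isProfile_indicator (solution v).continuous.Icc_extend'

theorem kernelProfile_sub (v : ℂ) {t : ℝ} (ht : t ∈ Set.Icc (-(1 / 2) : ℝ) (1 / 2)) :
    kernelProfile v t - triangleOp (kernelProfile v) t =
      Complex.exp (2 * π * Complex.I * v * t) := by
  have h := congrArg (fun ψ : C(Set.Icc (-(1 / 2) : ℝ) (1 / 2), ℂ) => ψ ⟨t, ht⟩) (solution_sub v)
  simp only [ContinuousMap.sub_apply] at h
  rw [kernelProfile, Set.indicator_of_mem ht, triangleOp_indicator, Set.IccExtend_of_mem _ _ ht]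
  exact h

theorem continuous_transform_kernelProfile (z : ℂ) :
    Continuous fun v => transform (kernelProfile v) z := by
  simp only [kernelProfile, transform_indicator]
  refine intervalIntegral.continuous_parametric_intervalIntegral_of_continuous' ?_ _ _
  have h1 : Continuous fun p : ℂ × ℝ => solution p.1 (Set.projIcc _ _ neg_half_le_half p.2) :=
    ContinuousEval.continuous_eval.comp ((continuous_solution.comp continuous_fst).prodMk
      ((continuous_projIcc (h := neg_half_le_half)).comp continuous_snd))
  exact h1.mul (by fun_prop)

theorem kernelProfile_eq {v : ℂ} (hv : q v ≠ 0) :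
    kernelProfile v =
      Set.indicator (Set.Icc (-(1 / 2) : ℝ) (1 / 2)) (explicitSolution v) := by
  let ψ : C(Set.Icc (-(1 / 2) : ℝ) (1 / 2), ℂ) :=
    ⟨fun t => explicitSolution v t, (continuous_explicitSolution v).comp continuous_subtype_val⟩
  have hext : ∀ s ∈ Set.Icc (-(1 / 2) : ℝ) (1 / 2),
      Set.IccExtend neg_half_le_half ψ s = explicitSolution v s := fun s hs => by
    rw [Set.IccExtend_of_mem _ _ hs]
    rfl
  have hψ : ψ = solution v := by
    refine eq_solution ?_
    ext t
    have h1 : triangleCLM ψ t = ∫ s in (-(1 / 2) : ℝ)..(1 / 2),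
        explicitSolution v s * ((1 - |(t : ℝ) - s| : ℝ) : ℂ) := by
      refine intervalIntegral.integral_congr fun s hs => ?_
      rw [Set.uIcc_of_le neg_half_le_half] at hs
      simp only [hext s hs]
    rw [ContinuousMap.sub_apply, h1]
    exact explicitSolution_sub hv t.2
  rw [kernelProfile, ← hψ]
  ext t
  by_cases ht : t ∈ Set.Icc (-(1 / 2) : ℝ) (1 / 2)
  · rw [Set.indicator_of_mem ht, Set.indicator_of_mem ht, hext t ht]
  · rw [Set.indicator_of_notMem ht, Set.indicator_of_notMem ht]

/-- The entire function that agrees with `gFormula` off its poles. -/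
noncomputable def gSinc (z : ℂ) : ℂ := (sincPi (z - a / π) + sincPi (z + a / π)) / 2

/-- The entire function that agrees with `hFormula` off its poles. -/
noncomputable def hSinc (z : ℂ) : ℂ := (sincPi (z - a / π) - sincPi (z + a / π)) / 2

theorem pi_ne_zero_complex : (π : ℂ) ≠ 0 := by exact_mod_cast Real.pi_ne_zero

theorem transform_explicitSolution (v z : ℂ) :
    transform (Set.indicator (Set.Icc (-(1 / 2) : ℝ) (1 / 2)) (explicitSolution v)) z =
      f v z + c v * gSinc z + d v * hSinc z := by
  have hI : ∀ k l : ℂ, IntervalIntegrable (fun t : ℝ =>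
      k * Complex.exp (-(2 * π * Complex.I * l * t))) volume (-(1 / 2)) (1 / 2) := fun k l =>
    Continuous.intervalIntegrable (by fun_prop) _ _
  have hπ := pi_ne_zero_complex
  have h : ∀ t : ℝ, explicitSolution v t * Complex.exp (-(2 * π * Complex.I * z * t)) =
      2 * (π : ℂ) ^ 2 * v ^ 2 / (2 * (π : ℂ) ^ 2 * v ^ 2 - 1) *
        Complex.exp (-(2 * π * Complex.I * (z - v) * t)) +
      (c v + d v) / 2 * Complex.exp (-(2 * π * Complex.I * (z - a / π) * t)) +
      (c v - d v) / 2 * Complex.exp (-(2 * π * Complex.I * (z + a / π) * t)) := by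
    intro t
    have e1 : Complex.exp (-(2 * π * Complex.I * (z - v) * t)) =
        Complex.exp (2 * π * Complex.I * v * t) * Complex.exp (-(2 * π * Complex.I * z * t)) := by
      rw [← Complex.exp_add]
      congr 1
      ring
    have e2 : Complex.exp (-(2 * π * Complex.I * (z - a / π) * t)) =
        Complex.exp (2 * Complex.I * a * t) * Complex.exp (-(2 * π * Complex.I * z * t)) := by
      rw [← Complex.exp_add]
      congr 1
      field_simp
      ring
    have e3 : Complex.exp (-(2 * π * Complex.I * (z + a / π) * t)) =
        Complex.exp (-(2 * Complex.I * a) * t) * Complex.exp (-(2 * π * Complex.I * z * t)) := by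
      rw [← Complex.exp_add]
      congr 1
      field_simp
      ring
    rw [e1, e2, e3, explicitSolution]
    ring
  rw [transform_indicator]
  simp only [h]
  rw [intervalIntegral.integral_add ((hI _ _).add (hI _ _)) (hI _ _),
    intervalIntegral.integral_add (hI _ _) (hI _ _), intervalIntegral.integral_const_mul,
    intervalIntegral.integral_const_mul, intervalIntegral.integral_const_mul,
    integral_exp_eq_sincPi, integral_exp_eq_sincPi, integral_exp_eq_sincPi, f, gSinc, hSinc]
  ring

theorem q_factor (z : ℂ) : q z = -2 * (π * (z - a / π)) * (π * (z + a / π)) := by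
  have hπ := pi_ne_zero_complex
  have e1 : π * (z - a / π) = π * z - a := by field_simp
  have e2 : π * (z + a / π) = π * z + a := by field_simp
  rw [e1, e2, q]
  linear_combination -2 * a_sq

theorem sincPi_of_ne {z : ℂ} (hz : z ≠ 0) : sincPi z = Complex.sin (π * z) / (π * z) := if_neg hz

theorem ne_zero_of_q_ne_zero {z : ℂ} (hz : q z ≠ 0) : z - a / π ≠ 0 ∧ z + a / π ≠ 0 := by
  rw [q_factor] at hz
  constructor
  · intro h
    rw [h] at hz
    simp at hz
  · intro h
    rw [h] at hz
    simp at hz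

theorem gSinc_eq {z : ℂ} (hz : q z ≠ 0) : gSinc z = gFormula z := by
  obtain ⟨h1, h2⟩ := ne_zero_of_q_ne_zero hz
  have hπ := pi_ne_zero_complex
  rw [gSinc, gFormula, sincPi_of_ne h1, sincPi_of_ne h2, sqrt_two_eq]
  have e1 : π * (z - a / π) = π * z - a := by field_simp
  have e2 : π * (z + a / π) = π * z + a := by field_simp
  have h3 := mul_ne_zero hπ h1
  have h4 := mul_ne_zero hπ h2
  rw [q_factor, e1, e2] at *
  rw [Complex.sin_sub, Complex.sin_add]
  field_simp
  ring

theorem hSinc_eq {z : ℂ} (hz : q z ≠ 0) : hSinc z = hFormula z := by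
  obtain ⟨h1, h2⟩ := ne_zero_of_q_ne_zero hz
  have hπ := pi_ne_zero_complex
  rw [hSinc, hFormula, sincPi_of_ne h1, sincPi_of_ne h2, sqrt_two_eq]
  have e1 : π * (z - a / π) = π * z - a := by field_simp
  have e2 : π * (z + a / π) = π * z + a := by field_simp
  have h3 := mul_ne_zero hπ h1
  have h4 := mul_ne_zero hπ h2
  rw [q_factor, e1, e2] at *
  rw [Complex.sin_sub, Complex.sin_add]
  field_simp
  ring

theorem continuous_sincPi : Continuous sincPi := by
  have : sincPi = transform unitBox := (funext transform_unitBox).symm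
  rw [this]
  exact isProfile_unitBox.differentiable_transform.continuous

theorem eventually_q_ne_zero (z : ℂ) : ∀ᶠ w in 𝓝[≠] z, q w ≠ 0 := by
  have hfin : {w : ℂ | q w = 0}.Finite := by
    refine (Set.toFinite {(a / π : ℂ), -(a / π : ℂ)}).subset fun w hw => ?_
    have hπ := pi_ne_zero_complex
    rw [Set.mem_ofPred_eq, q_factor] at hw
    rcases mul_eq_zero.1 hw with h | h
    · left
      have : w - a / π = 0 := by simpa [hπ] using h
      linear_combination this
    · right
      have : w + a / π = 0 := by simpa [hπ] using h
      exact eq_neg_of_add_eq_zero_left this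
  have hopen : IsOpen ({w : ℂ | q w = 0} \ {z})ᶜ := (hfin.subset Set.sdiff_subset).isClosed.isOpen_compl
  refine eventually_nhdsWithin_iff.2 ?_
  filter_upwards [hopen.mem_nhds (fun h => h.2 rfl : z ∈ ({w : ℂ | q w = 0} \ {z})ᶜ)] with w hw hwz hq
  exact hw ⟨hq, hwz⟩

theorem g_eq (z : ℂ) : g z = gSinc z := by
  rw [g]
  split_ifs with h
  · refine Tendsto.limUnder_eq ?_
    have hc : Continuous gSinc := by
      unfold gSinc
      exact ((continuous_sincPi.comp (by fun_prop)).add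
        (continuous_sincPi.comp (by fun_prop))).div_const _
    refine Tendsto.congr' ?_ ((hc.tendsto z).mono_left nhdsWithin_le_nhds)
    filter_upwards [eventually_q_ne_zero z] with w hw
    exact gSinc_eq hw
  · exact (gSinc_eq h).symm

theorem h_eq (z : ℂ) : h z = hSinc z := by
  rw [h]
  split_ifs with h'
  · refine Tendsto.limUnder_eq ?_
    have hc : Continuous hSinc := by
      unfold hSinc
      exact ((continuous_sincPi.comp (by fun_prop)).sub
        (continuous_sincPi.comp (by fun_prop))).div_const _
    refine Tendsto.congr' ?_ ((hc.tendsto z).mono_left nhdsWithin_le_nhds)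
    filter_upwards [eventually_q_ne_zero z] with w hw
    exact hSinc_eq hw
  · exact (hSinc_eq h').symm

theorem kernelFormula_eq {w : ℂ} (hw : q (conj w) ≠ 0) (z : ℂ) :
    kernelFormula w z = transform (kernelProfile (conj w)) z := by
  rw [kernelProfile_eq hw, transform_explicitSolution, kernelFormula, g_eq, h_eq]

theorem q_conj (w : ℂ) : q (conj w) = conj (q w) := by
  simp [q, Complex.conj_ofNat]

/-- The kernel `K` as the Fourier transform of the solution of the integral equation. -/
theorem K_eq (w z : ℂ) : K w z = transform (kernelProfile (conj w)) z := by
  rw [K]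
  split_ifs with hq
  · refine Tendsto.limUnder_eq ?_
    have hc := (continuous_transform_kernelProfile z).comp Complex.continuous_conj
    refine Tendsto.congr' ?_ ((hc.tendsto w).mono_left nhdsWithin_le_nhds)
    filter_upwards [eventually_q_ne_zero w] with v hv
    refine (kernelFormula_eq ?_ z).symm
    rw [q_conj]
    simpa using hv
  · exact kernelFormula_eq hq z

theorem form_kernelProfile {φ : ℝ → ℂ} (hφ : IsProfile φ) (x : ℝ) :
    form φ (kernelProfile x) = transform φ x :=
  form_eq_transform hφ (isProfile_kernelProfile x) fun _ ht => kernelProfile_sub x ht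

theorem density_nonneg (x : ℝ) : 0 ≤ density x := by
  have h := Real.abs_sinc_le_one (π * x)
  rw [density]
  nlinarith [sq_abs (Real.sinc (π * x)), abs_nonneg (Real.sinc (π * x))]

theorem density_le_one (x : ℝ) : density x ≤ 1 := by
  rw [density]
  linarith [sq_nonneg (Real.sinc (π * x))]

theorem continuous_density : Continuous density := by
  unfold density
  exact continuous_const.sub ((Real.continuous_sinc.comp (by fun_prop)).pow 2)

theorem density_pos {x : ℝ} (hx : x ≠ 0) : 0 < density x := by
  have hx' : π * x ≠ 0 := mul_ne_zero Real.pi_ne_zero hx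
  have h : |Real.sinc (π * x)| < 1 := by
    rw [Real.sinc_of_ne_zero hx', abs_div, div_lt_one (abs_pos.2 hx')]
    exact Real.abs_sin_lt_abs hx'
  rw [density]
  nlinarith [sq_abs (Real.sinc (π * x)), abs_nonneg (Real.sinc (π * x))]

theorem IsProfile.sub {φ ψ : ℝ → ℂ} (hφ : IsProfile φ) (hψ : IsProfile ψ) :
    IsProfile (fun t => φ t - ψ t) :=
  ⟨hφ.memLp.sub hψ.memLp, fun t ht => by simp [hφ.eq_zero t ht, hψ.eq_zero t ht]⟩

theorem transform_sub {φ ψ : ℝ → ℂ} (hφ : IsProfile φ) (hψ : IsProfile ψ) (z : ℂ) :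
    transform (fun t => φ t - ψ t) z = transform φ z - transform ψ z := by
  unfold transform
  rw [← integral_sub (hφ.integrable_mul_exp z) (hψ.integrable_mul_exp z)]
  simp only [sub_mul]

theorem form_conj_symm (φ ψ : ℝ → ℂ) : conj (form φ ψ) = form ψ φ := by
  unfold form
  rw [← integral_conj]
  congr 1
  ext x
  rw [map_mul, map_mul, Complex.conj_conj, Complex.conj_ofReal]
  ring

theorem form_add_right {φ ψ χ : ℝ → ℂ} (hφ : IsProfile φ) (hψ : IsProfile ψ) (hχ : IsProfile χ) :
    form χ (fun t => φ t + ψ t) = form χ φ + form χ ψ := by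
  unfold form
  rw [← integral_add (integrable_form hχ hφ) (integrable_form hχ hψ)]
  congr 1
  ext x
  rw [transform_add hφ hψ, map_add]
  ring

theorem form_const_mul_right (φ ψ : ℝ → ℂ) (k : ℂ) :
    form φ (fun t => k * ψ t) = conj k * form φ ψ := by
  unfold form
  rw [← integral_const_mul]
  congr 1
  ext x
  rw [transform_const_mul, map_mul]
  ring

theorem form_sub_right {φ ψ χ : ℝ → ℂ} (hφ : IsProfile φ) (hψ : IsProfile ψ) (hχ : IsProfile χ) :
    form χ (fun t => φ t - ψ t) = form χ φ - form χ ψ := by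
  unfold form
  rw [← integral_sub (integrable_form hχ hφ) (integrable_form hχ hψ)]
  congr 1
  ext x
  rw [transform_sub hφ hψ, map_sub]
  ring

theorem form_sub_self {φ ψ : ℝ → ℂ} (hφ : IsProfile φ) (hψ : IsProfile ψ) :
    form (fun t => φ t - ψ t) (fun t => φ t - ψ t) =
      form φ φ - form φ ψ - conj (form φ ψ) + form ψ ψ := by
  rw [form_sub_right hφ hψ (hφ.sub hψ), ← form_conj_symm φ, ← form_conj_symm ψ,
    form_sub_right hφ hψ hφ, form_sub_right hφ hψ hψ, map_sub, map_sub, form_conj_symm,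
    form_conj_symm, form_conj_symm, form_conj_symm]
  ring

theorem form_self_eq (φ : ℝ → ℂ) :
    form φ φ = ((∫ x : ℝ, ‖transform φ x‖ ^ 2 * density x : ℝ) : ℂ) := by
  rw [← integral_complex_ofReal, form]
  congr 1
  ext x
  rw [Complex.mul_conj, Complex.normSq_eq_norm_sq]
  push_cast
  rfl

theorem form_self_nonneg (φ : ℝ → ℂ) : 0 ≤ (form φ φ).re := by
  rw [form_self_eq, Complex.ofReal_re]
  exact integral_nonneg fun x => mul_nonneg (by positivity) (density_nonneg x)

theorem integrable_form_self {φ : ℝ → ℂ} (hφ : IsProfile φ) :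
    Integrable fun x : ℝ => ‖transform φ x‖ ^ 2 * density x := by
  refine (integrable_form hφ hφ).re.congr (Eventually.of_forall fun x => ?_)
  simp only [RCLike.re_to_complex]
  rw [Complex.mul_conj, Complex.normSq_eq_norm_sq, ← Complex.ofReal_mul, Complex.ofReal_re]

theorem transform_eq_zero_of_form_self {φ : ℝ → ℂ} (hφ : IsProfile φ)
    (h : (form φ φ).re = 0) (z : ℂ) : transform φ z = 0 := by
  rw [form_self_eq, Complex.ofReal_re] at h
  have hnn : ∀ x : ℝ, 0 ≤ ‖transform φ x‖ ^ 2 * density x := fun x =>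
    mul_nonneg (by positivity) (density_nonneg x)
  have hae := (integral_eq_zero_iff_of_nonneg hnn (integrable_form_self hφ)).1 h
  have hcont : Continuous fun x : ℝ => ‖transform φ x‖ ^ 2 * density x :=
    (hφ.continuous_transform.norm.pow 2).mul continuous_density
  have hzero := (Continuous.ae_eq_iff_eq volume hcont continuous_const).1 hae
  have hne : ∀ x : ℝ, x ≠ 0 → transform φ x = 0 := by
    intro x hx
    have := congrFun hzero x
    rcases mul_eq_zero.1 this with h1 | h1
    · simpa using h1
    · exact absurd h1 (density_pos hx).ne'
  have hall : ∀ x : ℝ, transform φ x = 0 := by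
    have hd : Dense {x : ℝ | x ≠ 0} := dense_compl_singleton 0
    have := Continuous.ext_on hd hφ.continuous_transform continuous_const fun x hx => hne x hx
    exact congrFun this
  exact congrFun (eq_of_eq_ofReal hφ.differentiable_transform (differentiable_const 0) hall) z

theorem transform_eq_of_form_eq {φ ψ : ℝ → ℂ} (hφ : IsProfile φ) (hψ : IsProfile ψ)
    (h : ∀ χ, IsProfile χ → form χ φ = form χ ψ) (z : ℂ) : transform φ z = transform ψ z := by
  have h1 : (form (fun t => φ t - ψ t) (fun t => φ t - ψ t)).re = 0 := by
    rw [form_sub_self hφ hψ, form_conj_symm, h φ hφ, h ψ hψ]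
    simp
  have := transform_eq_zero_of_form_self (hφ.sub hψ) h1 z
  rw [transform_sub hφ hψ] at this
  exact sub_eq_zero.1 this

theorem conj_transform_kernelProfile (x y : ℝ) :
    conj (transform (kernelProfile x) y) = transform (kernelProfile x) y := by
  have hk := isProfile_kernelProfile x
  have h := transform_eq_of_form_eq (φ := fun t => conj (kernelProfile x (-t))) hk.reflect.conj hk
    (fun χ hχ => by
      rw [form_kernelProfile hχ]
      have h1 := form_kernelProfile hχ.reflect.conj x
      rw [transform_conj_reflect, Complex.conj_ofReal] at h1
      rw [← Complex.conj_conj (transform χ x), ← h1]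
      unfold form
      rw [← integral_conj]
      congr 1
      ext s
      simp only [transform_conj_reflect, Complex.conj_ofReal, map_mul, Complex.conj_conj]) y
  rw [transform_conj_reflect, Complex.conj_ofReal] at h
  exact h

theorem density_neg (x : ℝ) : density (-x) = density x := by
  rw [density, density, mul_neg, Real.sinc_neg]

theorem transform_kernelProfile_neg (x : ℝ) (z : ℂ) :
    transform (kernelProfile (-x : ℝ)) z = transform (kernelProfile x) (-z) := by
  rw [← transform_reflect]
  refine transform_eq_of_form_eq (isProfile_kernelProfile _) (isProfile_kernelProfile _).reflect
    (fun χ hχ => ?_) z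
  have h1 := form_kernelProfile hχ.reflect x
  rw [transform_reflect] at h1
  rw [form_kernelProfile hχ, Complex.ofReal_neg, ← h1]
  unfold form
  rw [← integral_neg_eq_self]
  congr 1
  ext s
  rw [transform_reflect, transform_reflect, density_neg, Complex.ofReal_neg, neg_neg]

theorem K_ofReal (x : ℝ) (z : ℂ) : K x z = transform (kernelProfile x) z := by
  rw [K_eq, Complex.conj_ofReal]

theorem K_neg_ofReal (x : ℝ) (z : ℂ) : K (-x) z = transform (kernelProfile (-x : ℝ)) z := by
  rw [← Complex.ofReal_neg, K_ofReal]

/-- The value `K(β, β)`. -/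
noncomputable def diag (β : ℝ) : ℝ := (K β β).re

/-- The value `K(β, -β)`. -/
noncomputable def offDiag (β : ℝ) : ℝ := (K β (-β)).re

theorem K_diag (β : ℝ) : K β β = diag β := by
  refine (Complex.conj_eq_iff_re.1 ?_).symm
  rw [K_ofReal, conj_transform_kernelProfile]

theorem K_offDiag (β : ℝ) : K β (-β) = offDiag β := by
  refine (Complex.conj_eq_iff_re.1 ?_).symm
  rw [K_ofReal, ← Complex.ofReal_neg, conj_transform_kernelProfile]

theorem transform_kernel_self (β : ℝ) : transform (kernelProfile β) β = diag β := by
  rw [← K_diag, K_ofReal]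

theorem transform_kernel_neg (β : ℝ) :
    transform (kernelProfile β) ((-β : ℝ) : ℂ) = offDiag β := by
  rw [← K_offDiag, K_ofReal, Complex.ofReal_neg]

theorem transform_kernel_neg_self (β : ℝ) :
    transform (kernelProfile (-β : ℝ)) β = offDiag β := by
  rw [transform_kernelProfile_neg, ← transform_kernel_neg, Complex.ofReal_neg]

theorem transform_kernel_neg_neg (β : ℝ) :
    transform (kernelProfile (-β : ℝ)) ((-β : ℝ) : ℂ) = diag β := by
  rw [transform_kernelProfile_neg, ← transform_kernel_self, Complex.ofReal_neg, neg_neg]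

theorem form_self_le {φ : ℝ → ℂ} (hφ : IsProfile φ) :
    (form φ φ).re ≤ (∫ t, φ t * conj (φ t)).re := by
  have h : (∫ t, φ t * conj (φ t)) = ((∫ x : ℝ, ‖transform φ x‖ ^ 2 : ℝ) : ℂ) := by
    rw [← integral_transform_mul_conj hφ hφ, ← integral_complex_ofReal]
    congr 1
    ext x
    rw [Complex.mul_conj, Complex.normSq_eq_norm_sq]
  rw [h, form_self_eq, Complex.ofReal_re, Complex.ofReal_re]
  refine integral_mono (integrable_form_self hφ) ?_ fun x => ?_
  · exact (memLp_two_iff_integrable_sq_norm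
      hφ.continuous_transform.aestronglyMeasurable).1 hφ.memLp_transform
  · exact mul_le_of_le_one_right (by positivity) (density_le_one x)

theorem one_le_diag (β : ℝ) : 1 ≤ diag β := by
  let e : ℝ → ℂ := fun t => Complex.exp (2 * π * Complex.I * β * t)
  let φ := Set.indicator (Set.Icc (-(1 / 2) : ℝ) (1 / 2)) e
  have hφ : IsProfile φ := isProfile_indicator (by fun_prop)
  have hk := isProfile_kernelProfile β
  have h1 : transform φ β = 1 := by
    rw [transform_indicator]
    have : ∀ t : ℝ, e t * Complex.exp (-(2 * π * Complex.I * β * t)) = 1 := by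
      intro t
      rw [← Complex.exp_add, add_neg_cancel, Complex.exp_zero]
    simp only [this]
    rw [intervalIntegral.integral_const]
    norm_num
  have h2 : ∫ t, φ t * conj (φ t) = 1 := by
    rw [← h1, transform]
    congr 1
    ext t
    by_cases ht : t ∈ Set.Icc (-(1 / 2) : ℝ) (1 / 2)
    · simp only [φ, Set.indicator_of_mem ht, e]
      rw [← Complex.exp_conj]
      congr 2
      simp [Complex.conj_ofNat]
    · simp only [φ, Set.indicator_of_notMem ht, zero_mul]
  have h3 := form_self_le hφ
  rw [h2, Complex.one_re] at h3
  have h4 := form_self_nonneg (fun t => φ t - kernelProfile β t)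
  rw [form_sub_self hφ hk, form_kernelProfile hφ, h1, form_kernelProfile hk,
    transform_kernel_self] at h4
  simp at h4
  linarith

/-- The reciprocal of `K(β, β) + |K(β, -β)|`. -/
noncomputable def weight (β : ℝ) : ℝ := 1 / (diag β + |offDiag β|)

theorem weight_pos (β : ℝ) : 0 < weight β := by
  have := one_le_diag β
  have := abs_nonneg (offDiag β)
  rw [weight]
  positivity

theorem weight_mul (β : ℝ) : weight β * (diag β + |offDiag β|) = 1 := by
  have := one_le_diag β
  have := abs_nonneg (offDiag β)
  rw [weight, one_div_mul_cancel (by positivity)]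

/-- The multiples of `u K(β, ·) + v K(-β, ·)` that occur as square roots of extremal functions. -/
noncomputable def candidate (β : ℝ) (u v : ℂ) (t : ℝ) : ℂ :=
  (weight β * u) * kernelProfile β t + (weight β * v) * kernelProfile (-β : ℝ) t

theorem isProfile_candidate (β : ℝ) (u v : ℂ) : IsProfile (candidate β u v) :=
  ((isProfile_kernelProfile _).const_mul _).add ((isProfile_kernelProfile _).const_mul _)

theorem transform_candidate (β : ℝ) (u v z : ℂ) :
    transform (candidate β u v) z = weight β * (u * K β z + v * K (-β) z) := by
  unfold candidate
  rw [transform_add ((isProfile_kernelProfile _).const_mul _)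
    ((isProfile_kernelProfile _).const_mul _), transform_const_mul, transform_const_mul,
    K_ofReal, K_neg_ofReal]
  ring

theorem form_candidate {φ : ℝ → ℂ} (hφ : IsProfile φ) (β : ℝ) (u v : ℂ) :
    form φ (candidate β u v) =
      weight β * (conj u * transform φ β + conj v * transform φ (-β : ℝ)) := by
  unfold candidate
  rw [form_add_right ((isProfile_kernelProfile _).const_mul _)
    ((isProfile_kernelProfile _).const_mul _) hφ, form_const_mul_right, form_const_mul_right,
    form_kernelProfile hφ, form_kernelProfile hφ, map_mul, map_mul, Complex.conj_ofReal]
  ring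

theorem transform_candidate_self (β : ℝ) (u v : ℂ) :
    transform (candidate β u v) β = weight β * (u * diag β + v * offDiag β) := by
  rw [transform_candidate, K_ofReal, K_neg_ofReal, transform_kernel_self,
    transform_kernel_neg_self]

theorem transform_candidate_neg (β : ℝ) (u v : ℂ) :
    transform (candidate β u v) (-β : ℝ) = weight β * (u * offDiag β + v * diag β) := by
  rw [transform_candidate, K_ofReal, K_neg_ofReal, transform_kernel_neg,
    transform_kernel_neg_neg]

/-- The defect in the lower bound for the form. -/
theorem form_self_eq_add {φ : ℝ → ℂ} (hφ : IsProfile φ) (β : ℝ) {u v : ℂ}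
    (hu : transform φ β = u) (hv : transform φ (-β : ℝ) = v) :
    (form φ φ).re = (form (fun t => φ t - candidate β u v t)
        (fun t => φ t - candidate β u v t)).re + weight β * (‖u‖ ^ 2 + ‖v‖ ^ 2) +
      weight β ^ 2 * (|offDiag β| * (‖u‖ ^ 2 + ‖v‖ ^ 2) - 2 * offDiag β * (u * conj v).re) := by
  have hc := isProfile_candidate β u v
  rw [form_sub_self hφ hc, form_candidate hφ, form_candidate hc, transform_candidate_self,
    transform_candidate_neg, hu, hv, ← Complex.normSq_eq_norm_sq, ← Complex.normSq_eq_norm_sq]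
  have hw := weight_mul β
  simp only [Complex.add_re, Complex.sub_re, Complex.mul_re, Complex.mul_im, Complex.add_im,
    Complex.conj_re, Complex.conj_im, Complex.ofReal_re, Complex.ofReal_im, Complex.normSq_apply]
  linear_combination (-weight β * (u.re * u.re + u.im * u.im + (v.re * v.re + v.im * v.im))) * hw

theorem mul_re_conj_le (s : ℝ) (u v : ℂ) :
    2 * s * (u * conj v).re ≤ |s| * (‖u‖ ^ 2 + ‖v‖ ^ 2) := by
  have h1 : |(u * conj v).re| ≤ ‖u‖ * ‖v‖ := by
    refine (Complex.abs_re_le_norm _).trans ?_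
    rw [norm_mul, RCLike.norm_conj]
  calc 2 * s * (u * conj v).re ≤ |2 * s * (u * conj v).re| := le_abs_self _
    _ = 2 * |s| * |(u * conj v).re| := by rw [abs_mul, abs_mul, abs_two]
    _ ≤ 2 * |s| * (‖u‖ * ‖v‖) := by gcongr
    _ ≤ |s| * (‖u‖ ^ 2 + ‖v‖ ^ 2) := by
      nlinarith [abs_nonneg s, mul_nonneg (abs_nonneg s) (sq_nonneg (‖u‖ - ‖v‖))]

theorem M_eq_form {R : ℂ → ℂ} {φ : ℝ → ℂ}
    (h : ∀ x : ℝ, R x = transform φ x * conj (transform φ x)) : M R = form φ φ := by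
  unfold M form
  simp only [h]

theorem mul_conj_re (w : ℂ) : (w * conj w).re = ‖w‖ ^ 2 := by
  rw [Complex.mul_conj, Complex.ofReal_re, Complex.normSq_eq_norm_sq]

theorem exists_profile_of_mem_Omega {β : ℝ} {R : ℂ → ℂ} (hR : R ∈ Omega β) :
    ∃ φ, IsProfile φ ∧ (∀ x : ℝ, R x = transform φ x * conj (transform φ x)) ∧
      1 ≤ ‖transform φ β‖ ^ 2 ∧ 1 ≤ ‖transform φ (-β : ℝ)‖ ^ 2 := by
  obtain ⟨hadm, hpos, h1, h2⟩ := hR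
  obtain ⟨φ, hφ, h⟩ := hadm.exists_profile hpos
  refine ⟨φ, hφ, h, ?_, ?_⟩
  · rwa [h, mul_conj_re] at h1
  · rwa [← Complex.ofReal_neg, h, mul_conj_re] at h2

/-- The condition on the values `u`, `v` at `β`, `-β` of the square root of an extremal
function. -/
structure IsExtremalPair (β : ℝ) (u v : ℂ) : Prop where
  norm_left : ‖u‖ = 1
  norm_right : ‖v‖ = 1
  re_eq : offDiag β * (u * conj v).re = |offDiag β|

theorem mul_offDiag_eq {s : ℝ} {u v : ℂ} (hu : ‖u‖ = 1) (hv : ‖v‖ = 1)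
    (h : s * (u * conj v).re = |s|) : v * s = u * |s| ∧ u * s = v * |s| := by
  have hu' : u.re ^ 2 + u.im ^ 2 = 1 := by
    have := Complex.normSq_eq_norm_sq u
    rw [hu, Complex.normSq_apply] at this
    linarith
  have hv' : v.re ^ 2 + v.im ^ 2 = 1 := by
    have := Complex.normSq_eq_norm_sq v
    rw [hv, Complex.normSq_apply] at this
    linarith
  simp only [Complex.mul_re, Complex.conj_re, Complex.conj_im] at h
  have hs := sq_abs s
  constructor
  · rw [← sub_eq_zero, ← Complex.normSq_eq_zero, Complex.normSq_apply]
    simp only [Complex.sub_re, Complex.sub_im, Complex.mul_re, Complex.mul_im,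
      Complex.ofReal_re, Complex.ofReal_im]
    linear_combination s ^ 2 * hv' + |s| ^ 2 * hu' - 2 * |s| * h - hs
  · rw [← sub_eq_zero, ← Complex.normSq_eq_zero, Complex.normSq_apply]
    simp only [Complex.sub_re, Complex.sub_im, Complex.mul_re, Complex.mul_im,
      Complex.ofReal_re, Complex.ofReal_im]
    linear_combination s ^ 2 * hu' + |s| ^ 2 * hv' - 2 * |s| * h - hs

/-- The function determined by an extremal pair. -/
noncomputable def extremal (β : ℝ) (u v : ℂ) (z : ℂ) : ℂ :=
  (weight β : ℂ) ^ 2 * (u * K β z + v * K (-β) z) * (conj u * K β z + conj v * K (-β) z)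

theorem extremal_ofReal (β : ℝ) (u v : ℂ) (x : ℝ) :
    extremal β u v x =
      transform (candidate β u v) x * conj (transform (candidate β u v) x) := by
  rw [transform_candidate, extremal, K_ofReal, K_neg_ofReal]
  simp only [map_mul, map_add, Complex.conj_ofReal, conj_transform_kernelProfile]
  ring

theorem differentiable_K (x : ℝ) : Differentiable ℂ (K x) := by
  have : K x = transform (kernelProfile x) := funext (K_ofReal x)
  rw [this]
  exact (isProfile_kernelProfile x).differentiable_transform

theorem differentiable_extremal (β : ℝ) (u v : ℂ) : Differentiable ℂ (extremal β u v) := by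
  have h1 := differentiable_K β
  have h2 := differentiable_K (-β)
  rw [Complex.ofReal_neg] at h2
  unfold extremal
  fun_prop

theorem candidate_values {β : ℝ} {u v : ℂ} (h : IsExtremalPair β u v) :
    transform (candidate β u v) β = u ∧ transform (candidate β u v) (-β : ℝ) = v := by
  obtain ⟨h1, h2⟩ := mul_offDiag_eq h.norm_left h.norm_right h.re_eq
  have hw : (weight β : ℂ) * (diag β + |offDiag β|) = 1 := by
    exact_mod_cast congrArg ((↑) : ℝ → ℂ) (weight_mul β)
  rw [transform_candidate_self, transform_candidate_neg, h1, h2]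
  constructor
  · linear_combination u * hw
  · linear_combination v * hw

theorem extremal_mem_Omega {β : ℝ} {u v : ℂ} (h : IsExtremalPair β u v) :
    extremal β u v ∈ Omega β := by
  obtain ⟨h1, h2⟩ := candidate_values h
  refine ⟨isAdmissible_of_eq_mul_conj (isProfile_candidate β u v) (differentiable_extremal β u v)
    (extremal_ofReal β u v), fun x => ?_, ?_, ?_⟩
  · rw [extremal_ofReal, Complex.mul_conj, Complex.ofReal_im, Complex.ofReal_re]
    exact ⟨rfl, Complex.normSq_nonneg _⟩
  · rw [extremal_ofReal, h1, mul_conj_re, h.norm_left]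
    norm_num
  · rw [← Complex.ofReal_neg, extremal_ofReal, h2, mul_conj_re, h.norm_right]
    norm_num

theorem M_extremal {β : ℝ} {u v : ℂ} (h : IsExtremalPair β u v) :
    M (extremal β u v) = ((2 * weight β : ℝ) : ℂ) := by
  obtain ⟨h1, h2⟩ := candidate_values h
  rw [M_eq_form (extremal_ofReal β u v), form_candidate (isProfile_candidate β u v), h1, h2,
    mul_comm (conj u), mul_comm (conj v), Complex.mul_conj, Complex.mul_conj,
    Complex.normSq_eq_norm_sq, Complex.normSq_eq_norm_sq, h.norm_left, h.norm_right]
  push_cast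
  ring

theorem exists_isExtremalPair (β : ℝ) : ∃ u v, IsExtremalPair β u v := by
  rcases le_total 0 (offDiag β) with h | h
  · exact ⟨1, 1, by simp, by simp, by simp [abs_of_nonneg h]⟩
  · exact ⟨-1, 1, by simp, by simp, by simp [abs_of_nonpos h]⟩

theorem isLeast_values (β : ℝ) : IsLeast (values β) (2 * weight β) := by
  constructor
  · obtain ⟨u, v, h⟩ := exists_isExtremalPair β
    exact ⟨extremal β u v, extremal_mem_Omega h, M_extremal h⟩
  · rintro m ⟨R, hR, hm⟩
    obtain ⟨φ, hφ, h, h1, h2⟩ := exists_profile_of_mem_Omega hR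
    have h3 := form_self_eq_add hφ β rfl rfl
    rw [← M_eq_form h, hm, Complex.ofReal_re] at h3
    have h4 := form_self_nonneg (fun t => φ t -
      candidate β (transform φ β) (transform φ (-β : ℝ)) t)
    have h5 := mul_re_conj_le (offDiag β) (transform φ β) (transform φ (-β : ℝ))
    have h6 := weight_pos β
    rw [h3]
    have h7 := mul_nonneg (sq_nonneg (weight β)) (sub_nonneg.2 h5)
    nlinarith

theorem Delta_eq (β : ℝ) : Delta β = 2 * weight β := (isLeast_values β).csInf_eq

theorem isExtremal_iff (β : ℝ) (R : ℂ → ℂ) :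
    IsExtremal β R ↔ ∃ u v, IsExtremalPair β u v ∧ R = extremal β u v := by
  constructor
  · rintro ⟨hR, hm⟩
    obtain ⟨φ, hφ, h, h1, h2⟩ := exists_profile_of_mem_Omega hR
    have h3 := form_self_eq_add hφ β rfl rfl
    rw [← M_eq_form h, hm, Complex.ofReal_re, Delta_eq] at h3
    have h4 := form_self_nonneg (fun t => φ t -
      candidate β (transform φ β) (transform φ (-β : ℝ)) t)
    have h5 := mul_re_conj_le (offDiag β) (transform φ β) (transform φ (-β : ℝ))
    have h6 := weight_pos β
    have h7 := mul_nonneg (sq_nonneg (weight β)) (sub_nonneg.2 h5)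
    have hu : ‖transform φ β‖ ^ 2 = 1 := by nlinarith
    have hv : ‖transform φ (-β : ℝ)‖ ^ 2 = 1 := by nlinarith
    rw [hu, hv] at h3 h7
    have h8 : (form (fun t => φ t - candidate β (transform φ β) (transform φ (-β : ℝ)) t)
        (fun t => φ t - candidate β (transform φ β) (transform φ (-β : ℝ)) t)).re = 0 := by
      linarith
    have h9 : weight β ^ 2 * (|offDiag β| * (1 + 1) - 2 * offDiag β *
        (transform φ β * conj (transform φ (-β : ℝ))).re) = 0 := by linarith
    have h10 := (mul_eq_zero.1 h9).resolve_left (by positivity)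
    refine ⟨transform φ β, transform φ (-β : ℝ), ⟨?_, ?_, by linarith⟩, ?_⟩
    · exact (pow_eq_one_iff_of_nonneg (norm_nonneg _) two_ne_zero).1 hu
    · exact (pow_eq_one_iff_of_nonneg (norm_nonneg _) two_ne_zero).1 hv
    · refine eq_of_eq_ofReal hR.1.entire (differentiable_extremal _ _ _) fun x => ?_
      have hc := isProfile_candidate β (transform φ β) (transform φ (-β : ℝ))
      have h11 := transform_eq_zero_of_form_self (hφ.sub hc) h8 x
      rw [transform_sub hφ hc] at h11
      rw [h, extremal_ofReal, sub_eq_zero.1 h11]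
  · rintro ⟨u, v, h, rfl⟩
    refine ⟨extremal_mem_Omega h, ?_⟩
    rw [M_extremal h, Delta_eq]

theorem norm_cos_ofReal_le (x : ℝ) : ‖Complex.cos x‖ ≤ 1 := by
  rw [← Complex.ofReal_cos, Complex.norm_real]
  exact Real.abs_cos_le_one x

theorem norm_sin_ofReal_le (x : ℝ) : ‖Complex.sin x‖ ≤ 1 := by
  rw [← Complex.ofReal_sin, Complex.norm_real]
  exact Real.abs_sin_le_one x

theorem norm_cos_pi_mul_le (x : ℝ) : ‖Complex.cos (π * x)‖ ≤ 1 := by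
  exact_mod_cast norm_cos_ofReal_le (π * x)

theorem norm_sin_pi_mul_le (x : ℝ) : ‖Complex.sin (π * x)‖ ≤ 1 := by
  exact_mod_cast norm_sin_ofReal_le (π * x)

theorem norm_q_ge {x : ℝ} (hx : 1 ≤ |x|) : π ^ 2 * |x| ^ 2 ≤ ‖q x‖ := by
  have h : q x = ((1 - 2 * π ^ 2 * x ^ 2 : ℝ) : ℂ) := by
    rw [q]
    push_cast
    rfl
  rw [h, Complex.norm_real, Real.norm_eq_abs]
  have h1 : 1 ≤ π ^ 2 * |x| ^ 2 := by
    have : 1 ≤ π * |x| := by nlinarith [Real.pi_gt_three]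
    rw [← mul_pow]
    nlinarith
  rw [sq_abs] at h1 ⊢
  rw [abs_of_nonpos (by linarith)]
  linarith

theorem norm_pi_mul (x : ℝ) : ‖(π : ℂ) * x‖ = π * |x| := by
  rw [norm_mul, Complex.norm_real, Complex.norm_real, Real.norm_eq_abs, Real.norm_eq_abs,
    abs_of_pos Real.pi_pos]

theorem norm_sqrt_two_le : ‖((√2 : ℝ) : ℂ)‖ ≤ 2 := by
  rw [Complex.norm_real, Real.norm_eq_abs, abs_of_nonneg (Real.sqrt_nonneg _)]
  exact Real.sqrt_le_iff.2 ⟨by norm_num, by norm_num⟩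

theorem one_le_norm_sqrt_two : 1 ≤ ‖((√2 : ℝ) : ℂ)‖ := by
  rw [Complex.norm_real, Real.norm_eq_abs, abs_of_nonneg (Real.sqrt_nonneg _)]
  exact Real.le_sqrt_of_sq_le (by norm_num)

theorem norm_cos_a_ge : 3 / 4 ≤ ‖Complex.cos a‖ := by
  rw [a, ← Complex.ofReal_cos, Complex.norm_real]
  exact real_a_bounds.1.trans (le_abs_self _)

theorem norm_cos_sub_ge : 1 / 4 ≤ ‖Complex.cos a - a * Complex.sin a‖ := by
  have h : Complex.cos a - a * Complex.sin a =
      ((Real.cos (1 / √2) - 1 / √2 * Real.sin (1 / √2) : ℝ) : ℂ) := by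
    rw [a]
    push_cast
    rfl
  rw [h, Complex.norm_real]
  exact real_a_bounds.2.trans (le_abs_self _)

theorem div_le_of_pi_sq {k y : ℝ} (hk : 0 ≤ k) (hy : 1 ≤ y) :
    k * (π * y) / (π ^ 2 * y ^ 2) ≤ k / y := by
  have hy0 : 0 < y := by linarith
  rw [div_le_div_iff₀ (by positivity) hy0]
  have : π ≤ π ^ 2 := by nlinarith [Real.pi_gt_three]
  calc k * (π * y) * y = k * y ^ 2 * π := by ring
    _ ≤ k * y ^ 2 * π ^ 2 := by gcongr
    _ = k * (π ^ 2 * y ^ 2) := by ring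

theorem norm_c_le {x : ℝ} (hx : 1 ≤ |x|) : ‖c x‖ ≤ 8 / |x| := by
  have hπx : 1 ≤ π * |x| := by nlinarith [Real.pi_gt_three]
  have hnum : ‖Complex.cos (π * x) - π * x * Complex.sin (π * x)‖ ≤ 2 * (π * |x|) := by
    refine (norm_sub_le _ _).trans ?_
    rw [norm_mul, norm_pi_mul]
    have h1 := norm_cos_pi_mul_le x
    have h2 := mul_le_mul_of_nonneg_left (norm_sin_pi_mul_le x) (by positivity : 0 ≤ π * |x|)
    linarith
  refine le_trans ?_ (div_le_of_pi_sq (by norm_num) hx)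
  rw [c, norm_div, norm_mul]
  calc _ ≤ 2 * (π * |x|) / (π ^ 2 * |x| ^ 2 * (1 / 4)) := by
        gcongr
        · exact norm_q_ge hx
        · exact norm_cos_sub_ge
    _ = 8 * (π * |x|) / (π ^ 2 * |x| ^ 2) := by
        have : |x| ≠ 0 := by linarith
        field_simp
        norm_num

theorem norm_d_le {x : ℝ} (hx : 1 ≤ |x|) : ‖d x‖ ≤ 8 / |x| := by
  have hnum : ‖2 * π * x * Complex.cos (π * x)‖ ≤ 2 * (π * |x|) := by
    rw [mul_assoc 2, norm_mul, norm_mul, norm_pi_mul, Complex.norm_ofNat]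
    have h2 := mul_le_mul_of_nonneg_left (norm_cos_pi_mul_le x) (by positivity : 0 ≤ π * |x|)
    linarith
  refine le_trans ?_ (div_le_of_pi_sq (by norm_num) hx)
  rw [d, norm_div, norm_mul (q x * _), norm_mul (q x)]
  have h4 : (1 / 4 : ℝ) ≤ ‖Complex.cos a‖ := by linarith [norm_cos_a_ge]
  calc _ ≤ 2 * (π * |x|) / (π ^ 2 * |x| ^ 2 * 1 * (1 / 4)) := by
        gcongr
        · exact norm_q_ge hx
        · exact one_le_norm_sqrt_two
    _ = 8 * (π * |x|) / (π ^ 2 * |x| ^ 2) := by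
        have : |x| ≠ 0 := by linarith
        field_simp
        norm_num

theorem norm_cos_a_le : ‖Complex.cos a‖ ≤ 1 := norm_cos_ofReal_le _

theorem norm_sin_a_le : ‖Complex.sin a‖ ≤ 1 := norm_sin_ofReal_le _

theorem norm_gFormula_le {x : ℝ} (hx : 1 ≤ |x|) : ‖gFormula x‖ ≤ 4 / |x| := by
  have hπx : 1 ≤ π * |x| := by nlinarith [Real.pi_gt_three]
  have hnum : ‖((√2 : ℝ) : ℂ) * Complex.sin a * Complex.cos (π * x) -
      2 * π * x * Complex.cos a * Complex.sin (π * x)‖ ≤ 4 * (π * |x|) := by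
    refine (norm_sub_le _ _).trans ?_
    rw [mul_assoc 2 (π : ℂ), norm_mul, norm_mul, norm_mul, norm_mul, norm_mul, norm_pi_mul,
      Complex.norm_ofNat]
    calc _ ≤ 2 * 1 * 1 + 2 * (π * |x|) * 1 * 1 := by
          gcongr
          · exact norm_sqrt_two_le
          · exact norm_sin_a_le
          · exact norm_cos_pi_mul_le x
          · exact norm_cos_a_le
          · exact norm_sin_pi_mul_le x
      _ ≤ _ := by linarith
  refine le_trans ?_ (div_le_of_pi_sq (by norm_num) hx)
  rw [gFormula, norm_div]
  gcongr
  exact norm_q_ge hx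

theorem norm_hFormula_le {x : ℝ} (hx : 1 ≤ |x|) : ‖hFormula x‖ ≤ 4 / |x| := by
  have hπx : 1 ≤ π * |x| := by nlinarith [Real.pi_gt_three]
  have hnum : ‖2 * π * x * Complex.sin a * Complex.cos (π * x) -
      ((√2 : ℝ) : ℂ) * Complex.cos a * Complex.sin (π * x)‖ ≤ 4 * (π * |x|) := by
    refine (norm_sub_le _ _).trans ?_
    rw [mul_assoc 2 (π : ℂ), norm_mul, norm_mul, norm_mul 2, norm_pi_mul, Complex.norm_ofNat,
      norm_mul, norm_mul]
    calc _ ≤ 2 * (π * |x|) * 1 * 1 + 2 * 1 * 1 := by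
          gcongr
          · exact norm_sin_a_le
          · exact norm_cos_pi_mul_le x
          · exact norm_sqrt_two_le
          · exact norm_cos_a_le
          · exact norm_sin_pi_mul_le x
      _ ≤ _ := by linarith
  refine le_trans ?_ (div_le_of_pi_sq (by norm_num) hx)
  rw [hFormula, norm_div]
  gcongr
  exact norm_q_ge hx

theorem q_ne_zero_of_one_le {x : ℝ} (hx : 1 ≤ |x|) : q x ≠ 0 := by
  intro h
  have h1 := norm_q_ge hx
  rw [h, norm_zero] at h1
  have : 0 < π ^ 2 * |x| ^ 2 := by
    have := Real.pi_pos
    positivity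
  linarith

theorem norm_K_sub_sincPi_le {x y : ℝ} (hx : 1 ≤ |x|) (hxy : |y| = |x|) :
    ‖K x y - sincPi (y - x)‖ ≤ 65 / x ^ 2 := by
  have hy : 1 ≤ |y| := hxy ▸ hx
  have hq := q_ne_zero_of_one_le hx
  have hx0 : 0 < |x| := by linarith
  rw [K_ofReal, kernelProfile_eq hq, transform_explicitSolution,
    gSinc_eq (q_ne_zero_of_one_le hy), hSinc_eq (q_ne_zero_of_one_le hy)]
  have hf : f x y - sincPi (y - x) = -(1 / q x) * sincPi (y - x) := by
    rw [f, q_eq]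
    have h : 2 * (π : ℂ) ^ 2 * (x : ℂ) ^ 2 / -q x = 1 - 1 / q x := by
      field_simp
      rw [q]
      ring
    rw [h]
    ring
  have hs : ‖sincPi (y - x)‖ ≤ 1 := by
    rw [← Complex.ofReal_sub, sincPi_ofReal, Complex.norm_real]
    exact Real.abs_sinc_le_one _
  have hq1 : ‖1 / q x‖ ≤ 1 / |x| ^ 2 := by
    rw [norm_div, norm_one]
    have h1 := norm_q_ge hx
    have h2 : 1 * |x| ^ 2 ≤ π ^ 2 * |x| ^ 2 := by
      gcongr
      nlinarith [Real.pi_gt_three]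
    have : 0 < |x| ^ 2 := by positivity
    exact one_div_le_one_div_of_le this (by linarith)
  have e : f x y + c x * gFormula y + d x * hFormula y - sincPi (y - x) =
      -(1 / q x) * sincPi (y - x) + (c x * gFormula y + d x * hFormula y) := by
    rw [← hf]
    ring
  rw [e, ← sq_abs x]
  calc _ ≤ ‖1 / q x‖ * ‖sincPi (y - x)‖ +
        (‖c x‖ * ‖gFormula y‖ + ‖d x‖ * ‖hFormula y‖) := by
        refine (norm_add_le _ _).trans (add_le_add ?_ ((norm_add_le _ _).trans ?_))
        · rw [norm_mul, norm_neg]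
        · rw [norm_mul, norm_mul]
    _ ≤ 1 / |x| ^ 2 * 1 + (8 / |x| * (4 / |x|) + 8 / |x| * (4 / |x|)) := by
        gcongr
        · exact norm_c_le hx
        · rw [← hxy]
          exact norm_gFormula_le hy
        · exact norm_d_le hx
        · rw [← hxy]
          exact norm_hFormula_le hy
    _ = 65 / |x| ^ 2 := by
        field_simp
        norm_num

theorem abs_diag_sub_one_le {β : ℝ} (hβ : 1 ≤ β) : |diag β - 1| ≤ 65 / β ^ 2 := by
  have h := norm_K_sub_sincPi_le (x := β) (y := β) (hβ.trans (le_abs_self β)) rfl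
  have e : K β β - sincPi (β - β) = ((diag β - 1 : ℝ) : ℂ) := by
    rw [K_diag, sub_self, sincPi, if_pos rfl]
    push_cast
    rfl
  rwa [e, Complex.norm_real] at h

theorem abs_offDiag_sub_le {β : ℝ} (hβ : 1 ≤ β) :
    |offDiag β - Real.sin (2 * π * β) / (2 * π * β)| ≤ 65 / β ^ 2 := by
  have h := norm_K_sub_sincPi_le (x := β) (y := -β) (hβ.trans (le_abs_self β)) (abs_neg β)
  have e : K β (-β : ℝ) - sincPi ((-β : ℝ) - β) =
      ((offDiag β - Real.sin (2 * π * β) / (2 * π * β) : ℝ) : ℂ) := by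
    rw [Complex.ofReal_neg, K_offDiag, ← Complex.ofReal_neg, ← Complex.ofReal_sub,
      sincPi_ofReal]
    have h1 : π * (-β - β) = -(2 * π * β) := by ring
    have h2 : 2 * π * β ≠ 0 := by
      have := Real.pi_pos
      positivity
    rw [h1, Real.sinc_neg, Real.sinc_of_ne_zero h2]
    push_cast
    rfl
  rwa [e, Complex.norm_real] at h

theorem Delta_eq_div (β : ℝ) : Delta β = 2 / (diag β + |offDiag β|) := by
  rw [Delta_eq, weight]
  ring

theorem abs_Delta_sub_le {β : ℝ} (hβ : 0 < β) :
    |Delta β - 2 * (1 - |Real.sin (2 * π * β) / (2 * π * β)|)| ≤ 262 / β ^ 2 := by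
  set s := Real.sin (2 * π * β) / (2 * π * β) with hs
  have h2πβ : 0 < 2 * π * β := by
    have := Real.pi_pos
    positivity
  have hs1 : |s| ≤ 1 := by
    rw [hs, ← Real.sinc_of_ne_zero h2πβ.ne']
    exact Real.abs_sinc_le_one _
  have hs0 := abs_nonneg s
  have hA := one_le_diag β
  have hB := abs_nonneg (offDiag β)
  have hD : 1 ≤ diag β + |offDiag β| := by linarith
  have hβ2 : 0 < β ^ 2 := by positivity
  rw [Delta_eq_div]
  rcases lt_or_ge β 1 with h | h
  · have h1 : 0 < 2 / (diag β + |offDiag β|) := by positivity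
    have h2 : 2 / (diag β + |offDiag β|) ≤ 2 := div_le_self (by norm_num) hD
    have h3 : (2 : ℝ) ≤ 262 / β ^ 2 := by
      rw [le_div_iff₀ hβ2]
      nlinarith
    rw [abs_le]
    constructor <;> linarith
  · have h1 := abs_diag_sub_one_le h
    have h2 := abs_offDiag_sub_le h
    rw [← hs] at h2
    have h3 : |(|offDiag β| - |s|)| ≤ 65 / β ^ 2 := (abs_abs_sub_abs_le _ _).trans h2
    have hs2 : s ^ 2 ≤ 1 / β ^ 2 := by
      rw [hs, div_pow]
      have h4 : Real.sin (2 * π * β) ^ 2 ≤ 1 := Real.sin_sq_le_one _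
      have h5 : β ^ 2 ≤ (2 * π * β) ^ 2 := by
        have : β ≤ 2 * π * β := by nlinarith [Real.pi_gt_three]
        gcongr
      gcongr
    have hid : 2 / (diag β + |offDiag β|) - 2 * (1 - |s|) =
        2 * (s ^ 2 - (1 - |s|) * ((diag β - 1) + (|offDiag β| - |s|))) /
          (diag β + |offDiag β|) := by
      rw [← sq_abs s]
      field_simp
      ring
    rw [hid, abs_div, abs_of_pos (by linarith : 0 < diag β + |offDiag β|)]
    refine (div_le_self (abs_nonneg _) hD).trans ?_
    rw [abs_mul, abs_two]
    have h6 : |(1 - |s|) * ((diag β - 1) + (|offDiag β| - |s|))| ≤ 130 / β ^ 2 := by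
      rw [abs_mul, abs_of_nonneg (by linarith : 0 ≤ 1 - |s|)]
      have h7 := (abs_add_le (diag β - 1) (|offDiag β| - |s|)).trans (add_le_add h1 h3)
      have h8 : 65 / β ^ 2 + 65 / β ^ 2 = 130 / β ^ 2 := by ring
      rw [h8] at h7
      exact (mul_le_of_le_one_left (abs_nonneg _) (by linarith)).trans h7
    have h9 : |s ^ 2 - (1 - |s|) * ((diag β - 1) + (|offDiag β| - |s|))| ≤
        1 / β ^ 2 + 130 / β ^ 2 := by
      refine (abs_sub _ _).trans (add_le_add ?_ h6)
      rwa [abs_of_nonneg (sq_nonneg s)]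
    have h10 : 262 / β ^ 2 = 2 * (1 / β ^ 2 + 130 / β ^ 2) := by ring
    rw [h10]
    gcongr

end PairCorrelation

theorem theorem4 :
    (∀ β : ℝ, 0 < β →
      ((PairCorrelation.Delta β : ℂ) =
        2 / (PairCorrelation.K β β + (‖PairCorrelation.K β (-β)‖ : ℂ))) ∧
      IsLeast (PairCorrelation.values β) (PairCorrelation.Delta β) ∧
      (PairCorrelation.K β (-β) = 0 → ∀ R : ℂ → ℂ, PairCorrelation.IsExtremal β R ↔
        ∃ c₁ c₂ : ℂ, ‖c₁‖ = 1 ∧ ‖c₂‖ = 1 ∧ ∀ z : ℂ,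
          R z = 1 / (PairCorrelation.K β β) ^ 2 *
            (c₁ * PairCorrelation.K β z + c₂ * PairCorrelation.K (-β) z) *
            (conj c₁ * PairCorrelation.K β z + conj c₂ * PairCorrelation.K (-β) z)) ∧
      (PairCorrelation.K β (-β) ≠ 0 → ∀ R : ℂ → ℂ, PairCorrelation.IsExtremal β R ↔
        ∀ z : ℂ, R z =
          (PairCorrelation.K β (-β) / (‖PairCorrelation.K β (-β)‖ : ℂ) * PairCorrelation.K β z +
              PairCorrelation.K (-β) z) ^ 2 /
            (PairCorrelation.K β β + (‖PairCorrelation.K β (-β)‖ : ℂ)) ^ 2)) ∧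
    ∃ C : ℝ, ∀ β : ℝ, 0 < β →
      |PairCorrelation.Delta β - 2 * (1 - |Real.sin (2 * π * β) / (2 * π * β)|)| ≤ C / β ^ 2 := by
  open PairCorrelation in
  refine ⟨fun β _ => ⟨?_, ?_, fun h0 R => ?_, fun hne R => ?_⟩, 262, fun β hβ =>
    abs_Delta_sub_le hβ⟩
  · rw [K_diag, K_offDiag, Complex.norm_real, Real.norm_eq_abs, Delta_eq_div]
    push_cast
    rfl
  · rw [Delta_eq]
    exact isLeast_values β
  · rw [K_offDiag, Complex.ofReal_eq_zero] at h0
    have hw : (weight β : ℂ) ^ 2 = 1 / (K β β) ^ 2 := by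
      rw [weight, h0, abs_zero, add_zero, K_diag]
      push_cast
      ring
    rw [isExtremal_iff]
    constructor
    · rintro ⟨u, v, h, rfl⟩
      refine ⟨u, v, h.norm_left, h.norm_right, fun z => ?_⟩
      rw [extremal, hw]
    · rintro ⟨u, v, hu, hv, h⟩
      refine ⟨u, v, ⟨hu, hv, by rw [h0, abs_zero, zero_mul]⟩, funext fun z => ?_⟩
      rw [h, extremal, hw]
  · rw [K_offDiag] at hne ⊢
    have hne' : offDiag β ≠ 0 := by simpa using hne
    have habs : ((|offDiag β| : ℝ) : ℂ) ≠ 0 := by simpa using hne'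
    have hw : (weight β : ℂ) ^ 2 = 1 / (K β β + ((|offDiag β| : ℝ) : ℂ)) ^ 2 := by
      rw [weight, K_diag]
      push_cast
      rw [one_div_pow]
    have hext : ∀ u v : ℂ, IsExtremalPair β u v → ∀ z, extremal β u v z =
        (offDiag β / ((|offDiag β| : ℝ) : ℂ) * K β z + K (-β) z) ^ 2 /
          (K β β + ((|offDiag β| : ℝ) : ℂ)) ^ 2 := by
      intro u v h z
      obtain ⟨h1, -⟩ := mul_offDiag_eq h.norm_left h.norm_right h.re_eq
      have hu : u = v * (offDiag β / ((|offDiag β| : ℝ) : ℂ)) := by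
        rw [← mul_div_assoc, h1]
        field_simp
      have hv : v * conj v = 1 := by
        rw [Complex.mul_conj, Complex.normSq_eq_norm_sq, h.norm_right]
        simp
      rw [extremal, hw, hu, map_mul, map_div₀, Complex.conj_ofReal, Complex.conj_ofReal]
      linear_combination (1 / (K β β + ((|offDiag β| : ℝ) : ℂ)) ^ 2 *
        (offDiag β / ((|offDiag β| : ℝ) : ℂ) * K β z + K (-β) z) ^ 2) * hv
    rw [isExtremal_iff, Complex.norm_real, Real.norm_eq_abs]
    constructor
    · rintro ⟨u, v, h, rfl⟩ z
      exact hext u v h z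
    · intro h
      obtain ⟨u, v, huv⟩ := exists_isExtremalPair β
      exact ⟨u, v, huv, funext fun z => by rw [h, hext u v huv]⟩
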